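/- **Proposition 3.1 (Bourgain–Gamburd machine).** There is an absolute constant $C>0$ with the following property. Let $G_0$ be a nontrivial finite group, let $S_0=\{s_1,\dots,s_k\}\subseteq G_0$ be a symmetric generating set with $k$ elements, let $0<\kappa,\beta<1$, and let $\delta:(0,\infty)\to(0,\infty)$ be a function with $0<\delta(\varepsilon)<\varepsilon$ for every $\varepsilon>0$. Suppose that the following three conditions hold for every quotient $G$ of $G_0$, where $\pi:G_0\to G$ is the quotient map. 1. (High multiplicity) Every faithful representation $\rho:G\to \mathrm{GL}_d(\mathbb C)$ with $d\ge 1$ satisfies $d\ge |G|^{\beta}$. 2. (Classification of approximate subgroups) For every $\varepsilon>0$, writing $\delta=\delta(\varepsilon)$, every $|G|^{\delta}$-approximate subgroup $A$ of $G$ either has size $|A|\ge |G|^{1-\varepsilon}$ or is contained in at most $[G:H]^{\varepsilon}/|G|^{\delta}$ left cosets of some subgroup $H\le G$. Here a $K$-approximate subgroup of $G$ is a finite symmetric set $A\subseteq G$ that contains $1$ and satisfies $AA\subseteq XA$ for some symmetric set $X\subseteq G$ with $|X|\le K$. 3. (Non-concentration) Let $\mu=\frac1k(\delta_{\pi(s_1)}+\dots+\delta_{\pi(s_k)})$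 be the push-forward to $G$ of the uniform probability measure on $S_0$, and let $\mu^{n}$ be its $n$-fold convolution power. There is an even integer $n$ with $0\le n\le \log|G|$ such that $\mu^{n}(H)\le [G:H]^{-\kappa}$ for all subgroups $H\le G$. Let $\lambda_1$ be the smallest nonzero eigenvalue of the Laplace operator $$\Delta f(x)=f(x)-\frac1k\sum_{s\in S_0} f(s^{-1}x)$$ of the Cayley graph $\mathrm{Cay}(G_0,S_0)$, acting on functions $f$ on $G_0$. Then $$\lambda_1\ \ge\ \beta\, e^{-C/\delta(\varepsilon)},\qquad \varepsilon=\tfrac14\min\{\beta,\kappa\}.$$ -/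

import Mathlib

open scoped Pointwise

noncomputable section

namespace BGMachine

/-- `A` is a `K`-approximate subgroup: it is symmetric, contains `1`, and `A * A ⊆ X * A` for some
symmetric set `X` with at most `K` elements. (Mathlib's `IsApproximateSubgroup` does not ask that
`X` be symmetric.) -/
structure IsApproxSubgroup {G : Type*} [Group G] (K : ℝ) (A : Finset G) : Prop where
  one_mem : (1 : G) ∈ A
  inv_mem : ∀ a ∈ A, a⁻¹ ∈ A
  exists_cover : ∃ X : Finset G, (∀ x ∈ X, x⁻¹ ∈ X) ∧ (X.card : ℝ) ≤ K ∧
    (A : Set G) * (A : Set G) ⊆ (X : Set G) * (A : Set G)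

section Measures

variable {G : Type*} [Group G] [Fintype G]

open Classical in
/-- The uniform probability measure on `S`, as a function. -/
def uniformMeasure (S : Finset G) : G → ℝ :=
  fun g => if g ∈ S then (S.card : ℝ)⁻¹ else 0

open Classical in
/-- The push-forward of a measure under a group homomorphism. Applied to `uniformMeasure S` with
`S = {s₁, …, s_k}` it is `(δ_{π s₁} + ⋯ + δ_{π s_k}) / k`. -/
def pushforward {G' : Type*} [Group G'] (π : G →* G') (μ : G → ℝ) : G' → ℝ :=
  fun y => ∑ x with π x = y, μ x

/-- Convolution of two functions on a finite group. -/
def conv (μ ν : G → ℝ) : G → ℝ :=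
  fun g => ∑ x, μ (g * x⁻¹) * ν x

open Classical in
/-- Convolution powers; the zeroth one is the Dirac mass at the identity. -/
def convPow (μ : G → ℝ) : ℕ → G → ℝ
  | 0 => fun g => if g = 1 then 1 else 0
  | n + 1 => conv μ (convPow μ n)

open Classical in
/-- The mass that `μ` gives to a subset. -/
def mass (μ : G → ℝ) (A : Set G) : ℝ :=
  ∑ x with x ∈ A, μ x

/-- The Laplace operator of the Cayley graph `Cay(G, S)`, for symmetric `S`:
`Δ f (x) = f x - (1 / |S|) ∑_{s ∈ S} f (s⁻¹ x)`. -/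
def laplacian (S : Finset G) : Module.End ℝ (G → ℝ) where
  toFun f := fun x => f x - (S.card : ℝ)⁻¹ * ∑ s ∈ S, f (s⁻¹ * x)
  map_add' f g := by
    funext x
    simp only [Pi.add_apply, Finset.sum_add_distrib]
    ring
  map_smul' c f := by
    funext x
    simp only [Pi.smul_apply, smul_eq_mul, RingHom.id_apply, ← Finset.mul_sum]
    ring

/-- The first nonzero eigenvalue of the Laplace operator of `Cay(G, S)`. (There are finitely many
eigenvalues, and a nonzero one exists as soon as `S` generates `G` and `G` is nontrivial.) -/
def lambda1 (S : Finset G) : ℝ :=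
  sInf {t : ℝ | t ≠ 0 ∧ (laplacian S).HasEigenvalue t}

end Measures

/-- Every faithful complex representation of `G`, on a nonzero space, has dimension at least
`|G| ^ β`. (Only the trivial group acts faithfully on the zero space.) -/
def HighMultiplicity (G : Type*) [Group G] (β : ℝ) : Prop :=
  ∀ (d : ℕ), 0 < d → ∀ ρ : G →* GL (Fin d) ℂ, Function.Injective ρ →
    (Nat.card G : ℝ) ^ β ≤ (d : ℝ)

/-- Every `|G| ^ δ`-approximate subgroup of `G` has size at least `|G| ^ (1 - ε)` or is contained in
at most `[G : H] ^ ε / |G| ^ δ` left cosets of some subgroup `H`. -/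
def ApproxSubgroupClassification (G : Type*) [Group G] (ε δ : ℝ) : Prop :=
  ∀ A : Finset G, IsApproxSubgroup ((Nat.card G : ℝ) ^ δ) A →
    (Nat.card G : ℝ) ^ (1 - ε) ≤ (A.card : ℝ) ∨
    ∃ (H : Subgroup G) (T : Finset (G ⧸ H)),
      (T.card : ℝ) ≤ (H.index : ℝ) ^ ε / (Nat.card G : ℝ) ^ δ ∧
      ∀ a ∈ A, (QuotientGroup.mk a : G ⧸ H) ∈ T

/-- For some even `n ≤ log |G|`, every subgroup `H` satisfies `μ ^ n (H) ≤ [G : H] ^ (-κ)`. -/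
def NonConcentration {G : Type*} [Group G] [Fintype G] (μ : G → ℝ) (κ : ℝ) : Prop :=
  ∃ n : ℕ, Even n ∧ (n : ℝ) ≤ Real.log (Nat.card G : ℝ) ∧
    ∀ H : Subgroup G, mass (convPow μ n) (H : Set G) ≤ (H.index : ℝ) ^ (-κ)

end BGMachine

end

/-! Let `t` be a nonzero eigenvalue of the Laplacian. Right translations commute with the Laplacian,
so they act on its eigenspace; let `N` be the kernel of this action. The eigenspace descends to `G =
G₀ ⧸ N`, which acts on it faithfully, so high multiplicity for this quotient gives it dimension at
least `|G| ^ β` (`exists_quotient_eigenspace`). On `G` it consists of eigenfunctions of convolution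
by the push-forward `μ`, with eigenvalue `1 - t`.

Bounding a trace gives `|G| ^ β * (1 - t) ^ (2 n) ≤ |G| ‖μ ^ n‖₂²` (`finrank_mul_pow_le`). If `‖μ ^
n‖₂² ≤ |G| ^ (2 ε - 1)` for some `n` of order `log |G|`, then `4 ε ≤ β` makes `(1 - t) ^ (2 n) ≤ |G|
^ (-β / 2)`, and this bounds `t` below.

Such an `n` is reached by repeated squaring. If squaring `ν = μ ^ m` does not reduce `‖ν‖₂²` by a
factor `T = |G| ^ (δ / 5000)`, then a level set of `ν` has large multiplicative energy, and a
Balog–Szemerédi–Gowers argument (`exists_small_tripling`) yields an approximate subgroup with a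
translate of large `ν`-mass (`exists_approxSubgroup`). By the classification it is either so large
that `ν` is already flat, or covered by few cosets of a subgroup. Non-concentration, extended to
cosets and longer walks in `mass_convPow_coset_le`, excludes the latter. As `‖ν‖₂² ≥ 1 / |G|`, about
`5000 / δ` squarings suffice (`exists_convPow_flat`).

Absorbing numerical constants into powers of `T` requires `T ≥ 40`. When `T ≤ 40`, `log |G|` is `O(1
/ δ)`, and a gap polynomial in `1 / |G|` is enough (`gap_ge_of_nonConcentration`). -/

namespace BGMachine

/-! ### Convolution and `ℓ²` norms on a finite group -/

section Convolution

variable {G : Type*} [Group G] [Fintype G]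

/-- The squared `ℓ²` norm of a function on a finite group. -/
def sqNorm (f : G → ℝ) : ℝ := ∑ x, f x ^ 2

/-- `μ` is a symmetric probability measure. -/
structure IsSymmProb (μ : G → ℝ) : Prop where
  nonneg : ∀ x, 0 ≤ μ x
  sum_eq_one : ∑ x, μ x = 1
  symm : ∀ x, μ x⁻¹ = μ x

lemma conv_eq_sum_mul_inv_mul (μ ν : G → ℝ) (g : G) :
    conv μ ν g = ∑ x, μ x * ν (x⁻¹ * g) := by
  unfold conv
  refine Fintype.sum_equiv ((Equiv.inv G).trans (Equiv.mulLeft g)) _ _ fun x => ?_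
  simp

lemma conv_assoc (μ ν τ : G → ℝ) : conv (conv μ ν) τ = conv μ (conv ν τ) := by
  funext g
  rw [conv_eq_sum_mul_inv_mul μ (conv ν τ)]
  simp only [conv_eq_sum_mul_inv_mul ν τ, conv_eq_sum_mul_inv_mul (conv μ ν) τ,
    conv_eq_sum_mul_inv_mul μ ν, Finset.sum_mul, Finset.mul_sum]
  rw [Finset.sum_comm]
  refine Finset.sum_congr rfl fun x _ => ?_
  refine Fintype.sum_equiv (Equiv.mulLeft x⁻¹) _ _ fun y => ?_
  simp [mul_assoc]

lemma convPow_zero_conv (μ f : G → ℝ) : conv (convPow μ 0) f = f := by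
  funext g
  rw [conv_eq_sum_mul_inv_mul, Finset.sum_eq_single 1] <;> simp +contextual [convPow]

lemma conv_convPow_zero (μ f : G → ℝ) : conv f (convPow μ 0) = f := by
  funext g
  unfold conv
  rw [Finset.sum_eq_single 1] <;> simp +contextual [convPow]

lemma convPow_succ (μ : G → ℝ) (n : ℕ) : convPow μ (n + 1) = conv μ (convPow μ n) := rfl

lemma convPow_one (μ : G → ℝ) : convPow μ 1 = μ := conv_convPow_zero μ μ

lemma convPow_add (μ : G → ℝ) (m n : ℕ) :
    convPow μ (m + n) = conv (convPow μ m) (convPow μ n) := by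
  induction m with
  | zero => rw [Nat.zero_add, convPow_zero_conv]
  | succ m ih => rw [Nat.add_right_comm, convPow_succ, ih, convPow_succ, conv_assoc]

lemma sum_conv (μ ν : G → ℝ) : ∑ x, conv μ ν x = (∑ x, μ x) * ∑ x, ν x := by
  simp only [conv_eq_sum_mul_inv_mul, Finset.sum_mul]
  rw [Finset.sum_comm]
  refine Finset.sum_congr rfl fun x _ => ?_
  rw [← Finset.mul_sum]
  congr 1
  exact Fintype.sum_equiv (Equiv.mulLeft x⁻¹) _ _ fun y => rfl

lemma conv_nonneg {μ ν : G → ℝ} (hμ : ∀ x, 0 ≤ μ x) (hν : ∀ x, 0 ≤ ν x) (g : G) :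
    0 ≤ conv μ ν g :=
  Finset.sum_nonneg fun _ _ => mul_nonneg (hμ _) (hν _)

lemma conv_inv (μ ν : G → ℝ) (g : G) :
    conv μ ν g⁻¹ = conv (fun x => ν x⁻¹) (fun x => μ x⁻¹) g := by
  rw [conv_eq_sum_mul_inv_mul]
  unfold conv
  refine Fintype.sum_equiv (Equiv.inv G) _ _ fun x => ?_
  simp [mul_comm]

lemma conv_mono {μ ν μ' ν' : G → ℝ} (hμ : ∀ x, 0 ≤ μ x) (hν : ∀ x, 0 ≤ ν x)
    (hμ' : ∀ x, μ x ≤ μ' x) (hν' : ∀ x, ν x ≤ ν' x) (g : G) : conv μ ν g ≤ conv μ' ν' g :=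
  Finset.sum_le_sum fun _ _ =>
    mul_le_mul (hμ' _) (hν' _) (hν _) ((hμ _).trans (hμ' _))

lemma add_conv (f g h : G → ℝ) (x : G) : conv (f + g) h x = conv f h x + conv g h x := by
  simp [conv, add_mul, Finset.sum_add_distrib]

lemma conv_add (f g h : G → ℝ) (x : G) : conv f (g + h) x = conv f g x + conv f h x := by
  simp [conv, mul_add, Finset.sum_add_distrib]

lemma sqNorm_nonneg {G : Type*} [Fintype G] (f : G → ℝ) : 0 ≤ sqNorm f := Finset.sum_nonneg fun _ _ => sq_nonneg _

/-- Young's inequality `‖f * g‖₂ ≤ ‖f‖₁ ‖g‖₂`. -/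
lemma sqNorm_conv_le {f : G → ℝ} (hf : ∀ x, 0 ≤ f x) (g : G → ℝ) :
    sqNorm (conv f g) ≤ (∑ x, f x) ^ 2 * sqNorm g := by
  have key : ∀ y, conv f g y ^ 2 ≤ (∑ x, f x) * ∑ x, f x * g (x⁻¹ * y) ^ 2 := fun y => by
    rw [conv_eq_sum_mul_inv_mul]
    refine Finset.sum_sq_le_sum_mul_sum_of_sq_le_mul _ (fun i _ => hf i)
      (fun i _ => mul_nonneg (hf i) (sq_nonneg _)) fun i _ => le_of_eq (by ring)
  calc sqNorm (conv f g) ≤ ∑ y, (∑ x, f x) * ∑ x, f x * g (x⁻¹ * y) ^ 2 :=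
        Finset.sum_le_sum fun y _ => key y
    _ = (∑ x, f x) ^ 2 * sqNorm g := by
        rw [← Finset.mul_sum, sq, mul_assoc]
        congr 1
        exact sum_conv f (fun x => g x ^ 2) ▸
          Finset.sum_congr rfl fun y _ => (conv_eq_sum_mul_inv_mul f (fun x => g x ^ 2) y).symm

/-- Young's inequality `‖f * g‖₂ ≤ ‖f‖₂ ‖g‖₁`. -/
lemma sqNorm_conv_le_right (f : G → ℝ) {g : G → ℝ} (hg : ∀ x, 0 ≤ g x) :
    sqNorm (conv f g) ≤ sqNorm f * (∑ x, g x) ^ 2 := by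
  have h := sqNorm_conv_le (f := fun x => g x⁻¹) (fun x => hg _) (fun x => f x⁻¹)
  have e : ∀ φ : G → ℝ, ∑ x, φ x⁻¹ = ∑ x, φ x := fun φ =>
    Fintype.sum_equiv (Equiv.inv G) _ _ fun _ => rfl
  have h1 : sqNorm (conv (fun x => g x⁻¹) (fun x => f x⁻¹)) = sqNorm (conv f g) := by
    unfold sqNorm
    rw [← e fun x => conv f g x ^ 2]
    exact Finset.sum_congr rfl fun x _ => by rw [conv_inv]
  have h2 : sqNorm (fun x => f x⁻¹) = sqNorm f := e fun x => f x ^ 2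
  rw [h1, h2, e g] at h
  linarith

lemma IsSymmProb.convPow {μ : G → ℝ} (hμ : IsSymmProb μ) (n : ℕ) : IsSymmProb (convPow μ n) := by
  induction n with
  | zero =>
    refine ⟨fun x => ?_, ?_, fun x => ?_⟩
    · unfold BGMachine.convPow; split_ifs <;> norm_num
    · rw [Finset.sum_eq_single 1] <;> simp +contextual [BGMachine.convPow]
    · by_cases h : x = 1 <;> simp [BGMachine.convPow, h]
  | succ n ih =>
    refine ⟨conv_nonneg hμ.nonneg ih.nonneg, ?_, fun x => ?_⟩
    · rw [convPow_succ, sum_conv, hμ.sum_eq_one, ih.sum_eq_one, one_mul]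
    · have : BGMachine.convPow μ (n + 1) = conv (BGMachine.convPow μ n) μ := by
        rw [convPow_add, convPow_one]
      rw [convPow_succ, conv_inv, funext ih.symm, funext hμ.symm, ← this, convPow_succ]

lemma IsSymmProb.sqNorm_pos {μ : G → ℝ} (hμ : IsSymmProb μ) : 0 < sqNorm μ := by
  refine (sqNorm_nonneg μ).lt_of_ne' fun h => ?_
  have h0 := (Finset.sum_eq_zero_iff_of_nonneg fun x _ => sq_nonneg (μ x)).1 h
  have : ∑ x, μ x = 0 := Finset.sum_eq_zero fun x hx => pow_eq_zero_iff two_ne_zero |>.1 (h0 x hx)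
  linarith [hμ.sum_eq_one]

lemma IsSymmProb.sqNorm_le_one {μ : G → ℝ} (hμ : IsSymmProb μ) : sqNorm μ ≤ 1 := by
  rw [← hμ.sum_eq_one]
  refine Finset.sum_le_sum fun x _ => ?_
  have : μ x ≤ 1 := hμ.sum_eq_one ▸
    Finset.single_le_sum (fun y _ => hμ.nonneg y) (Finset.mem_univ x)
  nlinarith [hμ.nonneg x]

/-- Cauchy–Schwarz. This floor on the `ℓ²` norm is what stops the iterated flattening. -/
lemma IsSymmProb.one_le_card_mul_sqNorm {μ : G → ℝ} (hμ : IsSymmProb μ) :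
    1 ≤ (Nat.card G : ℝ) * sqNorm μ := by
  have := sq_sum_le_card_mul_sum_sq (s := (Finset.univ : Finset G)) (f := μ)
  rw [hμ.sum_eq_one, Finset.card_univ] at this
  simpa [sqNorm] using this

lemma convPow_apply_eigenvector {μ f : G → ℝ} {α : ℝ} (h : conv μ f = α • f) (n : ℕ) :
    conv (convPow μ n) f = α ^ n • f := by
  induction n with
  | zero => simp [convPow_zero_conv]
  | succ n ih =>
    rw [convPow_succ, conv_assoc, ih]
    funext x
    have := congrFun h x
    simp only [conv, Pi.smul_apply, smul_eq_mul] at this ⊢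
    rw [pow_succ, mul_assoc, ← this, Finset.mul_sum]
    exact Finset.sum_congr rfl fun y _ => by ring

end Convolution

/-! ### Popular values and dependent random choice -/

section SmallTripling

open Finset

/-- If `r` has large second moment, then much of its mass lies where it is large. -/
lemma popular_values {ι : Type*} [Fintype ι] (r : ι → ℝ) {n K : ℝ} (hn : 0 < n) (hK : 0 < K)
    (h0 : ∀ x, 0 ≤ r x) (hr : ∀ x, r x ≤ n) (hsum : ∑ x, r x ≤ n ^ 2)
    (hsq : n ^ 3 / K ≤ ∑ x, r x ^ 2) (P : Finset ι) (hP : ∀ x, x ∈ P ↔ n / (2 * K) ≤ r x) :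
    n ^ 2 / (2 * K) ≤ ∑ x ∈ P, r x ∧ (#P : ℝ) ≤ 2 * K * n := by
  classical
  constructor
  -- The unpopular values carry at most half of the second moment.
  · have h1 : ∑ x ∈ Pᶜ, r x ^ 2 ≤ n / (2 * K) * n ^ 2 := by
      calc ∑ x ∈ Pᶜ, r x ^ 2 ≤ ∑ x ∈ Pᶜ, n / (2 * K) * r x := by
            refine sum_le_sum fun x hx => ?_
            rw [mem_compl, hP, not_le] at hx
            nlinarith [h0 x]
        _ = n / (2 * K) * ∑ x ∈ Pᶜ, r x := by rw [mul_sum]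
        _ ≤ n / (2 * K) * n ^ 2 := by
            have := sum_le_sum_of_subset_of_nonneg (subset_univ Pᶜ) fun x _ _ => h0 x
            gcongr
            exact this.trans hsum
    have h2 : ∑ x ∈ P, r x ^ 2 ≤ n * ∑ x ∈ P, r x := by
      rw [mul_sum]
      exact sum_le_sum fun x _ => by nlinarith [h0 x, hr x]
    have h3 := sum_add_sum_compl P fun x => r x ^ 2
    have h4 : n * (n ^ 2 / (2 * K)) ≤ n * ∑ x ∈ P, r x := by
      have e1 : n / (2 * K) * n ^ 2 = n ^ 3 / K / 2 := by field_simp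
      have e2 : n * (n ^ 2 / (2 * K)) = n ^ 3 / K / 2 := by field_simp
      linarith
    exact le_of_mul_le_mul_left h4 hn
  · have h1 : (#P : ℝ) * (n / (2 * K)) ≤ n ^ 2 := by
      rw [← nsmul_eq_mul]
      refine (card_nsmul_le_sum P r _ fun x hx => (hP x).1 hx).trans ?_
      exact (sum_le_sum_of_subset_of_nonneg (subset_univ P) fun x _ _ => h0 x).trans hsum
    have h2 : (#P : ℝ) * (n / (2 * K)) * (2 * K) = #P * n := by field_simp
    have h3 : (#P : ℝ) * n ≤ 2 * K * n * n := by
      rw [← h2]; nlinarith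
    exact le_of_mul_le_mul_right h3 hn

lemma card_mul_le_card_of_le_card_fiber {α β : Type*} [DecidableEq β] (s : Finset α)
    (t : Finset β) (f : α → β) {c : ℝ} (h : ∀ y ∈ t, c ≤ #{x ∈ s | f x = y}) :
    #t * c ≤ #s := by
  rw [← nsmul_eq_mul]
  refine (card_nsmul_le_sum t (fun y => (#{x ∈ s | f x = y} : ℝ)) c h).trans ?_
  rw [← Nat.cast_sum]
  rw [sum_card_fiberwise_eq_card_filter]
  exact_mod_cast card_filter_le _ _

lemma sum_sq_card_fiber {α β : Type*} [Fintype β] [DecidableEq β] (s : Finset α) (f : α → β) :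
    ∑ y, #{x ∈ s | f x = y} ^ 2 = #{p ∈ s ×ˢ s | f p.1 = f p.2} := by
  rw [card_eq_sum_card_fiberwise (f := fun p => f p.1) (t := univ) (by simp)]
  refine sum_congr rfl fun y _ => ?_
  rw [sq, ← card_product]
  congr 1
  ext p
  simp only [mem_product, mem_filter]
  grind

section DependentChoice

variable {α : Type*} (A : Finset α) (E : α → α → Prop)

open Classical in
/-- The number of common neighbours in `A` of the pair `p`. -/
noncomputable def codegree (p : α × α) : ℕ := #{b ∈ A | E p.1 b ∧ E p.2 b}

open Classical in
/-- Dependent random choice: some vertex `b` has a neighbourhood in which many pairs have large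
codegree, and few pairs have very small codegree. -/
lemma exists_neighbourhood {K L : ℝ} (hA : A.Nonempty) (hK : 0 < K) (hL : 0 < L)
    (hE : (#A : ℝ) ^ 2 / K ≤ #{p ∈ A ×ˢ A | E p.1 p.2}) :
    ∃ B ⊆ A,
      (#A : ℝ) ^ 2 / (2 * K ^ 2) ≤
        #{p ∈ B ×ˢ B | (#A : ℝ) / (4 * K ^ 2) ≤ codegree A E p} ∧
      (#{p ∈ B ×ˢ B | (codegree A E p : ℝ) < #A / (4 * L * K ^ 2)} : ℝ) ≤ (#A : ℝ) ^ 2 / L := by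
  set n : ℝ := (#A : ℝ) with hn
  have hn0 : 0 < n := by rw [hn]; exact_mod_cast hA.card_pos
  let N : α → Finset α := fun b => {a ∈ A | E a b}
  let low : ℝ → α → Finset (α × α) := fun τ b => {p ∈ N b ×ˢ N b | (codegree A E p : ℝ) < τ}
  -- Double counting: a pair lies in `N b × N b` for exactly as many `b ∈ A` as its codegree.
  have hlow : ∀ τ, 0 ≤ τ → ∑ b ∈ A, (#(low τ b) : ℝ) ≤ n ^ 2 * τ := by
    intro τ hτ
    let D : Finset (α × α) := {p ∈ A ×ˢ A | (codegree A E p : ℝ) < τ}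
    have h1 : ∑ b ∈ A, #(low τ b) = ∑ p ∈ D, codegree A E p := by
      have := sum_card_bipartiteAbove_eq_sum_card_bipartiteBelow
        (s := A) (t := D) (fun b p => E p.1 b ∧ E p.2 b)
      refine Eq.trans (sum_congr rfl fun b _ => congrArg card ?_) this
      ext p
      simp only [low, N, D, bipartiteAbove, mem_filter, mem_product]
      tauto
    rw [← Nat.cast_sum, h1, Nat.cast_sum]
    calc ∑ p ∈ D, (codegree A E p : ℝ) ≤ ∑ p ∈ D, τ :=
          sum_le_sum fun p hp => (mem_filter.1 hp).2.le
      _ = #D * τ := by rw [sum_const, nsmul_eq_mul]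
      _ ≤ n ^ 2 * τ := by
          have : #D ≤ #A * #A := (card_filter_le _ _).trans_eq (card_product A A)
          have : (#D : ℝ) ≤ n ^ 2 := by rw [sq, hn]; exact_mod_cast this
          gcongr
  have hdeg : n ^ 3 / K ^ 2 ≤ ∑ b ∈ A, (#(N b) : ℝ) ^ 2 := by
    have h1 : #{p ∈ A ×ˢ A | E p.1 p.2} = ∑ b ∈ A, #(N b) := by
      rw [card_eq_sum_card_fiberwise (f := Prod.snd) (t := A)
        (fun p hp => (mem_product.1 (mem_filter.1 hp).1).2)]
      refine sum_congr rfl fun b hb => ?_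
      refine card_bij' (fun p _ => p.1) (fun a _ => (a, b)) ?_ ?_ ?_ ?_ <;>
        simp +contextual [N, hb, Prod.ext_iff]
      rintro a b _ _ h rfl; exact h
    rw [h1, Nat.cast_sum] at hE
    have h2 : (∑ b ∈ A, (#(N b) : ℝ)) ^ 2 ≤ n * ∑ b ∈ A, (#(N b) : ℝ) ^ 2 :=
      sq_sum_le_card_mul_sum_sq
    have h3 : (n ^ 2 / K) ^ 2 ≤ (∑ b ∈ A, (#(N b) : ℝ)) ^ 2 := by gcongr
    have h4 : (n ^ 2 / K) ^ 2 = n * (n ^ 3 / K ^ 2) := by field_simp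
    rw [h4] at h3
    exact le_of_mul_le_mul_left (h3.trans h2) hn0
  -- A single quantity encodes both conclusions: each penalty costs at most a quarter of the lower
  -- bound for `∑ |N b| ^ 2`. The weight `L` turns nonnegativity at the chosen `b` into the bound `n
  -- ^ 2 / L` on very bad pairs.
  have hX : ∑ b ∈ A, n ^ 2 / (2 * K ^ 2) ≤ ∑ b ∈ A, ((#(N b) : ℝ) ^ 2 -
      #(low (n / (4 * K ^ 2)) b) - L * #(low (n / (4 * L * K ^ 2)) b)) := by
    rw [sum_sub_distrib, sum_sub_distrib, ← mul_sum, sum_const, nsmul_eq_mul, ← hn]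
    have a1 := hlow (n / (4 * K ^ 2)) (by positivity)
    have a2 := mul_le_mul_of_nonneg_left (hlow (n / (4 * L * K ^ 2)) (by positivity)) hL.le
    have e0 : n * (n ^ 2 / (2 * K ^ 2)) = n ^ 3 / K ^ 2 / 2 := by field_simp
    have e1 : n ^ 2 * (n / (4 * K ^ 2)) = n ^ 3 / K ^ 2 / 4 := by field_simp
    have e2 : L * (n ^ 2 * (n / (4 * L * K ^ 2))) = n ^ 3 / K ^ 2 / 4 := by field_simp
    linarith
  obtain ⟨b, hb, hbX⟩ := exists_le_of_sum_le hA hX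
  have hpos : 0 ≤ n ^ 2 / (2 * K ^ 2) := by positivity
  have hsub : N b ⊆ A := filter_subset _ _
  refine ⟨N b, hsub, ?_, ?_⟩
  · have h1 : #(N b) ^ 2 = #{p ∈ N b ×ˢ N b | n / (4 * K ^ 2) ≤ codegree A E p} +
        #(low (n / (4 * K ^ 2)) b) := by
      rw [sq, ← card_product, ← card_filter_add_card_filter_not
        (s := N b ×ˢ N b) (fun p => n / (4 * K ^ 2) ≤ codegree A E p)]
      simp only [not_le, low]
    have h2 : (#(N b) : ℝ) ^ 2 = #{p ∈ N b ×ˢ N b | n / (4 * K ^ 2) ≤ codegree A E p} +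
        #(low (n / (4 * K ^ 2)) b) := by exact_mod_cast h1
    have : 0 ≤ L * #(low (n / (4 * L * K ^ 2)) b) := by positivity
    linarith
  · rw [le_div_iff₀ hL]
    have h1 : (#(N b) : ℝ) ≤ n := by rw [hn]; exact_mod_cast card_le_card hsub
    have h2 : (#(N b) : ℝ) ^ 2 ≤ n ^ 2 := by gcongr
    have : (0 : ℝ) ≤ #(low (n / (4 * K ^ 2)) b) := by positivity
    have h3 : L * #(low (n / (4 * L * K ^ 2)) b) ≤ n ^ 2 := by linarith
    simpa [low, mul_comm] using h3

end DependentChoice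

end SmallTripling

/-! ### Balog–Szemerédi–Gowers: from energy to small tripling -/

section EnergyToTripling

open Finset

variable {G : Type*} [Group G] [DecidableEq G]

/-- The quotients `a a'⁻¹` of pairs with at least `τ` common neighbours, when adjacency is
given by a set `P`, are few. -/
lemma card_image_codegree_le (A P : Finset G) {τ : ℝ} (D : Finset (G × G))
    (hD : ∀ p ∈ D, τ ≤ codegree A (fun a b => a * b⁻¹ ∈ P) p) :
    #(D.image fun p => p.1 * p.2⁻¹) * τ ≤ (#P : ℝ) ^ 2 := by
  classical
  have h := card_mul_le_card_of_le_card_fiber (c := τ) (P ×ˢ P) (D.image fun p => p.1 * p.2⁻¹)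
    (fun p => p.1 * p.2⁻¹) ?_
  · rwa [card_product, Nat.cast_mul, ← sq] at h
  · intro y hy
    obtain ⟨p, hp, rfl⟩ := mem_image.1 hy
    refine (hD p hp).trans ?_
    unfold codegree
    -- Each common neighbour `b` writes `p.1 p.2⁻¹` as `(p.1 b⁻¹) (p.2 b⁻¹)⁻¹`, a quotient of two
    -- elements of `P`.
    refine Nat.cast_le.2 (card_le_card_of_injOn (fun b => (p.1 * b⁻¹, p.2 * b⁻¹)) ?_ ?_)
    · intro b hb
      simp only [coe_filter, Set.mem_ofPred_eq] at hb
      simp [hb.2.1, hb.2.2]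
    · intro b _ b' _ h
      simpa using congrArg Prod.fst h

/-- The energy counting `a b⁻¹ = c d⁻¹` is at most the one counting `a⁻¹ b = c⁻¹ d`. -/
lemma energy_le_energy [Fintype G] (B : Finset G) :
    ∑ x, #{p ∈ B ×ˢ B | p.1 * p.2⁻¹ = x} ^ 2 ≤ ∑ x, #{p ∈ B ×ˢ B | p.1⁻¹ * p.2 = x} ^ 2 := by
  rw [sum_sq_card_fiber, sum_sq_card_fiber]
  -- `a b⁻¹ = c d⁻¹` is equivalent to `c⁻¹ a = d⁻¹ b`.
  refine card_le_card_of_injOn (fun q => ((q.2.1, q.1.1), (q.2.2, q.1.2))) ?_ ?_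
  · rintro ⟨⟨a, b⟩, c, d⟩ h
    simp only [coe_filter, mem_product, Set.mem_ofPred_eq] at h ⊢
    refine ⟨by tauto, ?_⟩
    rw [inv_mul_eq_iff_eq_mul, ← mul_assoc, ← h.2]
    simp
  · rintro ⟨⟨a, b⟩, c, d⟩ _ ⟨⟨a', b'⟩, c', d'⟩ _ h
    simp only [Prod.mk.injEq] at h ⊢
    tauto

lemma card_fiber_mul_inv_le (B : Finset G) (x : G) : #{p ∈ B ×ˢ B | p.1 * p.2⁻¹ = x} ≤ #B := by
  refine card_le_card_of_injOn Prod.fst (fun p hp => ?_) ?_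
  · simp only [coe_filter, mem_product, Set.mem_ofPred_eq] at hp
    exact hp.1.1
  · rintro ⟨a, b⟩ h ⟨a', b'⟩ h' (rfl : a = a')
    simp only [coe_filter, mem_product, Set.mem_ofPred_eq] at h h'
    have := h.2.trans h'.2.symm
    simpa using this

lemma card_fiber_inv_mul_le (B : Finset G) (x : G) : #{p ∈ B ×ˢ B | p.1⁻¹ * p.2 = x} ≤ #B := by
  refine card_le_card_of_injOn Prod.fst (fun p hp => ?_) ?_
  · simp only [coe_filter, mem_product, Set.mem_ofPred_eq] at hp
    exact hp.1.1
  · rintro ⟨a, b⟩ h ⟨a', b'⟩ h' (rfl : a = a')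
    simp only [coe_filter, mem_product, Set.mem_ofPred_eq] at h h'
    have := h.2.trans h'.2.symm
    simpa using this

lemma card_fiber_inv_mul_eq (B : Finset G) (x : G) :
    #{p ∈ B ×ˢ B | p.1⁻¹ * p.2 = x} = #{a ∈ B | a * x ∈ B} := by
  refine card_bij' (fun p _ => p.1) (fun a _ => (a, a * x)) ?_ ?_ ?_ ?_
  · rintro ⟨a, b⟩ h
    simp only [mem_filter, mem_product] at h ⊢
    obtain ⟨⟨ha, hb⟩, rfl⟩ := h
    simpa [ha] using hb
  · intro a h
    simpa using h
  · rintro ⟨a, b⟩ h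
    simp only [mem_filter, mem_product] at h
    simp [← h.2]
  · simp

lemma sum_card_fiber_prod {G : Type*} [Fintype G] [DecidableEq G] (B : Finset G) (f : G × G → G) :
    ∑ x, #{p ∈ B ×ˢ B | f p = x} = #B ^ 2 := by
  rw [← card_eq_sum_card_fiberwise (f := f) (by simp), card_product, sq]

/-- If every `x ∈ S` has many representations `x = a⁻¹ a'` in `B`, and most quotients `a a'⁻¹`
of elements of `B` lie in a small set `Q`, then `S` has small tripling. -/
lemma card_pow_three_mul_le (B S Q : Finset G) {n M : ℝ} (hM : 0 < M) (hn : 0 ≤ n)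
    (hB : (#B : ℝ) ≤ n) (hS : ∀ x ∈ S, n / M ≤ #{a ∈ B | a * x ∈ B})
    (hQ : (#{p ∈ B ×ˢ B | p.1 * p.2⁻¹ ∉ Q} : ℝ) ≤ n ^ 2 / (4 * M ^ 3)) :
    #(S ^ 3) * (n ^ 3 / (2 * M ^ 3)) ≤ n ^ 2 * (#Q : ℝ) ^ 2 := by
  have h := card_mul_le_card_of_le_card_fiber (c := n ^ 3 / (2 * M ^ 3)) (B ×ˢ Q ×ˢ Q ×ˢ B)
    (S ^ 3) (fun p => p.1⁻¹ * p.2.1 * p.2.2.1 * p.2.2.2) ?_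
  · refine h.trans ?_
    have hB2 : (#B : ℝ) ^ 2 ≤ n ^ 2 := by gcongr
    have := mul_le_mul_of_nonneg_right hB2 (sq_nonneg (#Q : ℝ))
    simp only [card_product, Nat.cast_mul]
    linarith
  · intro y hy
    rw [pow_succ, sq] at hy
    obtain ⟨z, hz, x₃, hx₃, rfl⟩ := mem_mul.1 hy
    obtain ⟨x₁, hx₁, x₂, hx₂, rfl⟩ := mem_mul.1 hz
    let R : G → Finset G := fun x => {a ∈ B | a * x ∈ B}
    let bad : Finset (G × G) := {p ∈ B ×ˢ B | p.1 * p.2⁻¹ ∉ Q}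
    let bad' : G → Finset (G × G) := fun x => {p ∈ R x ×ˢ B | p.1 * x * p.2⁻¹ ∉ Q}
    have hbad' : ∀ x, (#(bad' x) : ℝ) ≤ n ^ 2 / (4 * M ^ 3) := fun x => by
      refine le_trans (Nat.cast_le.2 ?_) hQ
      refine card_le_card_of_injOn (fun p => (p.1 * x, p.2)) ?_ ?_
      · rintro ⟨a, b⟩ h
        simp only [bad', R, coe_filter, mem_product, mem_filter, Set.mem_ofPred_eq] at h ⊢
        tauto
      · rintro ⟨a, b⟩ _ ⟨a', b'⟩ _ h
        simpa using h
    -- For `(a, b, c)` in `T`, `x₁ x₂ x₃ = a⁻¹ (a x₁ b⁻¹) (b x₂ c⁻¹) (c x₃)`, with outer factors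
    -- from `B` and inner ones in `Q`. Of at least `n ^ 3 / M ^ 3` triples, each condition on `Q`
    -- excludes at most a quarter of that number.
    let T : Finset (G × G × G) := {t ∈ R x₁ ×ˢ R x₂ ×ˢ R x₃ |
      t.1 * x₁ * t.2.1⁻¹ ∈ Q ∧ t.2.1 * x₂ * t.2.2⁻¹ ∈ Q}
    have hcov : #(R x₁) * (#(R x₂) * #(R x₃)) ≤ #T + #(bad' x₁) * #B + #B * #(bad' x₂) := by
      have e1 : #({t ∈ R x₁ ×ˢ R x₂ ×ˢ R x₃ | t.1 * x₁ * t.2.1⁻¹ ∉ Q}) ≤ #(bad' x₁) * #B := by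
        rw [← card_product]
        refine card_le_card_of_injOn (fun t => ((t.1, t.2.1), t.2.2)) ?_ ?_
        · rintro ⟨a, b, c⟩ h
          simp only [bad', R, coe_filter, coe_product, mem_product, mem_filter,
            Set.mem_ofPred_eq, Set.mem_prod, mem_coe] at h ⊢
          tauto
        · rintro ⟨a, b, c⟩ _ ⟨a', b', c'⟩ _ h
          simpa [and_assoc] using h
      have e2 : #({t ∈ R x₁ ×ˢ R x₂ ×ˢ R x₃ | t.2.1 * x₂ * t.2.2⁻¹ ∉ Q}) ≤ #B * #(bad' x₂) := by
        rw [← card_product]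
        refine card_le_card ?_
        rintro ⟨a, b, c⟩ h
        simp only [bad', R, mem_product, mem_filter] at h ⊢
        tauto
      rw [← card_product, ← card_product]
      refine le_trans (card_le_card (t := (T ∪
        {t ∈ R x₁ ×ˢ R x₂ ×ˢ R x₃ | t.1 * x₁ * t.2.1⁻¹ ∉ Q}) ∪
        {t ∈ R x₁ ×ˢ R x₂ ×ˢ R x₃ | t.2.1 * x₂ * t.2.2⁻¹ ∉ Q}) ?_) ?_
      · intro t ht
        simp only [T, mem_union, mem_filter]
        tauto
      · refine (card_union_le _ _).trans (add_le_add ((card_union_le _ _).trans ?_) e2)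
        exact Nat.add_le_add_left e1 _
    have hT : n ^ 3 / (2 * M ^ 3) ≤ #T := by
      have c1 : (#(R x₁) : ℝ) * (#(R x₂) * #(R x₃)) ≤ #T + #(bad' x₁) * #B + #B * #(bad' x₂) := by
        exact_mod_cast hcov
      have c2 : n / M * (n / M * (n / M)) ≤ (#(R x₁) : ℝ) * (#(R x₂) * #(R x₃)) := by
        have : 0 ≤ n / M := by positivity
        have b1 := hS x₁ hx₁
        have b2 := hS x₂ hx₂
        have b3 := hS x₃ hx₃
        gcongr
      have c3 : (#(bad' x₁) : ℝ) * #B ≤ n ^ 2 / (4 * M ^ 3) * n :=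
        mul_le_mul (hbad' _) hB (by positivity) (by positivity)
      have c4 : (#B : ℝ) * #(bad' x₂) ≤ n * (n ^ 2 / (4 * M ^ 3)) :=
        mul_le_mul hB (hbad' _) (by positivity) (by positivity)
      have e1 : n / M * (n / M * (n / M)) = n ^ 3 / M ^ 3 := by field_simp
      have e2 : n ^ 2 / (4 * M ^ 3) * n = n ^ 3 / M ^ 3 / 4 := by field_simp
      have e3 : n ^ 3 / (2 * M ^ 3) = n ^ 3 / M ^ 3 / 2 := by field_simp
      linarith
    refine hT.trans (Nat.cast_le.2 ?_)
    refine card_le_card_of_injOn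
      (fun t => (t.1, t.1 * x₁ * t.2.1⁻¹, t.2.1 * x₂ * t.2.2⁻¹, t.2.2 * x₃)) ?_ ?_
    · rintro ⟨a, b, c⟩ h
      simp only [T, R, coe_filter, mem_product, mem_filter, Set.mem_ofPred_eq] at h ⊢
      refine ⟨by tauto, by group⟩
    · rintro ⟨a, b, c⟩ _ ⟨a', b', c'⟩ _ h
      simp only [Prod.mk.injEq] at h ⊢
      obtain ⟨rfl, h1, -, h2⟩ := h
      exact ⟨rfl, by simpa using h1, by simpa using h2⟩

/-- A set many of whose quotients lie in a small set `P` correlates with a translate of a set of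
small tripling. -/
lemma exists_small_tripling_of_popular [Fintype G] (A P : Finset G) {n k M : ℝ} (hn : n = #A)
    (hA : A.Nonempty) (hk0 : 0 < k) (hM : M = 32 * k ^ 8) (hP2 : (#P : ℝ) ≤ k * n)
    (hedges : n ^ 2 / k ≤ #{p ∈ A ×ˢ A | p.1 * p.2⁻¹ ∈ P}) :
    ∃ S : Finset G, 1 ∈ S ∧ S⁻¹ = S ∧ (#(S ^ 3) : ℝ) ≤ 512 * M ^ 9 * k ^ 8 * n ∧
      n / M ≤ #S ∧ ∃ a, n / M ≤ #{x ∈ A | a⁻¹ * x ∈ S} := by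
  classical
  have hn0 : 0 < n := by rw [hn]; exact_mod_cast hA.card_pos
  have hM0 : 0 < M := by rw [hM]; positivity
  obtain ⟨B, hBA, hB1, hB2⟩ := exists_neighbourhood A (fun a b => a * b⁻¹ ∈ P) hA hk0
    (L := 4 * M ^ 3) (by positivity)
    (by rw [← hn]; convert hedges)
  rw [← hn] at hB1 hB2
  have hBn : (#B : ℝ) ≤ n := by rw [hn]; exact_mod_cast card_le_card hBA
  have hQcard : ∀ t : ℝ, 0 < t → ∀ Q : Finset G, #Q * (n / t) ≤ (#P : ℝ) ^ 2 →
      (#Q : ℝ) ≤ t * k ^ 2 * n := by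
    intro t ht Q hQ
    have h1 : (#P : ℝ) ^ 2 ≤ (k * n) ^ 2 := by gcongr
    have h2 : (#Q : ℝ) * (n / t) * t = #Q * n := by field_simp
    have h3 : (#Q : ℝ) * n ≤ t * k ^ 2 * n * n := by
      rw [← h2]; nlinarith
    exact le_of_mul_le_mul_right h3 hn0
  -- the second energy
  let D₁ : Finset (G × G) :=
    {p ∈ B ×ˢ B | n / (4 * k ^ 2) ≤ codegree A (fun a b => a * b⁻¹ ∈ P) p}
  let Q₁ : Finset G := D₁.image fun p => p.1 * p.2⁻¹
  have hQ₁ : (#Q₁ : ℝ) ≤ 4 * k ^ 2 * k ^ 2 * n :=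
    hQcard _ (by positivity) _ (card_image_codegree_le A P D₁ fun p hp => (mem_filter.1 hp).2)
  -- Many pairs of `B` have their quotient in the small set `Q₁`, so Cauchy–Schwarz makes the energy
  -- large; it is then moved to the left quotients `a⁻¹ b`, which define `S`.
  have hE1 : n ^ 3 / (16 * k ^ 8) ≤ ∑ x, (#{p ∈ B ×ˢ B | p.1⁻¹ * p.2 = x} : ℝ) ^ 2 := by
    have h1 : n ^ 2 / (2 * k ^ 2) ≤ ∑ x ∈ Q₁, (#{p ∈ B ×ˢ B | p.1 * p.2⁻¹ = x} : ℝ) := by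
      refine hB1.trans ?_
      rw [← Nat.cast_sum, sum_card_fiberwise_eq_card_filter]
      refine Nat.cast_le.2 (card_le_card fun p hp => ?_)
      exact mem_filter.2 ⟨(mem_filter.1 hp).1, mem_image_of_mem _ hp⟩
    have h2 : (∑ x ∈ Q₁, (#{p ∈ B ×ˢ B | p.1 * p.2⁻¹ = x} : ℝ)) ^ 2 ≤
        #Q₁ * ∑ x ∈ Q₁, (#{p ∈ B ×ˢ B | p.1 * p.2⁻¹ = x} : ℝ) ^ 2 := sq_sum_le_card_mul_sum_sq
    have h3 : ∑ x ∈ Q₁, (#{p ∈ B ×ˢ B | p.1 * p.2⁻¹ = x} : ℝ) ^ 2 ≤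
        ∑ x, (#{p ∈ B ×ˢ B | p.1⁻¹ * p.2 = x} : ℝ) ^ 2 := by
      refine (sum_le_sum_of_subset_of_nonneg (subset_univ _) fun _ _ _ => sq_nonneg _).trans ?_
      exact_mod_cast energy_le_energy B
    have h4 : (n ^ 2 / (2 * k ^ 2)) ^ 2 ≤ (4 * k ^ 2 * k ^ 2 * n) *
        ∑ x, (#{p ∈ B ×ˢ B | p.1⁻¹ * p.2 = x} : ℝ) ^ 2 := by
      refine (pow_le_pow_left₀ (by positivity) h1 2).trans (h2.trans ?_)
      gcongr
    have h5 : (n ^ 2 / (2 * k ^ 2)) ^ 2 = (4 * k ^ 2 * k ^ 2 * n) * (n ^ 3 / (16 * k ^ 8)) := by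
      field_simp; ring
    rw [h5] at h4
    exact le_of_mul_le_mul_left h4 (by positivity)
  let S : Finset G := {x | n / (2 * (16 * k ^ 8)) ≤ #{p ∈ B ×ˢ B | p.1⁻¹ * p.2 = x}}
  have hMe : 2 * (16 * k ^ 8) = M := by rw [hM]; ring
  have hs : ∀ x, (#{p ∈ B ×ˢ B | p.1⁻¹ * p.2 = x} : ℝ) ≤ n := fun x =>
    (Nat.cast_le.2 (card_fiber_inv_mul_le B x)).trans hBn
  have hsum : ∑ x, (#{p ∈ B ×ˢ B | p.1⁻¹ * p.2 = x} : ℝ) ≤ n ^ 2 := by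
    rw [← Nat.cast_sum, sum_card_fiber_prod B fun p => p.1⁻¹ * p.2, Nat.cast_pow]
    gcongr
  obtain ⟨hS1, -⟩ := popular_values _ hn0 (K := 16 * k ^ 8) (by positivity)
    (fun _ => Nat.cast_nonneg _) hs hsum hE1 S (by simp [S])
  have hSmem : ∀ x, x ∈ S ↔ n / M ≤ #{a ∈ B | a * x ∈ B} := fun x => by
    rw [← card_fiber_inv_mul_eq]; simp [S, hMe]
  rw [hMe] at hS1
  have hScard : n / M ≤ #S := by
    have h1 : ∑ x ∈ S, (#{p ∈ B ×ˢ B | p.1⁻¹ * p.2 = x} : ℝ) ≤ #S * n := by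
      rw [← nsmul_eq_mul]
      exact sum_le_card_nsmul _ _ _ fun x _ => hs x
    have h2 : n ^ 2 / M = n / M * n := by ring
    rw [h2] at hS1
    exact le_of_mul_le_mul_right (hS1.trans h1) hn0
  have hSne : S.Nonempty := by
    rw [← card_pos, ← Nat.cast_pos (α := ℝ)]
    exact lt_of_lt_of_le (by positivity) hScard
  have hBlow : n / M ≤ #B := by
    obtain ⟨x, hx⟩ := hSne
    exact ((hSmem x).1 hx).trans (Nat.cast_le.2 (card_filter_le _ _))
  refine ⟨S, ?_, ?_, ?_, hScard, ?_⟩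
  · rw [hSmem]
    simpa [filter_mem_eq_inter] using hBlow
  · ext x
    rw [mem_inv', hSmem, hSmem]
    have : #{a ∈ B | a * x⁻¹ ∈ B} = #{a ∈ B | a * x ∈ B} := by
      refine card_bij' (fun a _ => a * x⁻¹) (fun a _ => a * x) ?_ ?_ ?_ ?_ <;>
        simp +contextual
    rw [this]
  -- The pairs in `D₁` may be only a small proportion, but the tripling count needs all but `n ^ 2 /
  -- (4 M ^ 3)` pairs. The lower codegree threshold ensures this at the price of a larger quotient
  -- set.
  · let D₂ : Finset (G × G) := {p ∈ B ×ˢ B | n / (4 * (4 * M ^ 3) * k ^ 2) ≤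
      codegree A (fun a b => a * b⁻¹ ∈ P) p}
    let Q₂ : Finset G := D₂.image fun p => p.1 * p.2⁻¹
    have hQ₂ : (#Q₂ : ℝ) ≤ 4 * (4 * M ^ 3) * k ^ 2 * k ^ 2 * n :=
      hQcard _ (by positivity) _ (card_image_codegree_le A P D₂ fun p hp => (mem_filter.1 hp).2)
    have h := card_pow_three_mul_le B S Q₂ hM0 hn0.le hBn (fun x hx => (hSmem x).1 hx) ?_
    · have h1 : (#Q₂ : ℝ) ^ 2 ≤ (4 * (4 * M ^ 3) * k ^ 2 * k ^ 2 * n) ^ 2 := by gcongr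
      have h2 := h.trans (mul_le_mul_of_nonneg_left h1 (sq_nonneg n))
      have h3 : n ^ 2 * (4 * (4 * M ^ 3) * k ^ 2 * k ^ 2 * n) ^ 2 =
          512 * M ^ 9 * k ^ 8 * n * (n ^ 3 / (2 * M ^ 3)) := by
        field_simp; ring
      rw [h3] at h2
      exact le_of_mul_le_mul_right h2 (by positivity)
    · refine le_trans (Nat.cast_le.2 (card_le_card fun p hp => ?_)) hB2
      rw [mem_filter] at hp ⊢
      refine ⟨hp.1, lt_of_not_ge fun hle => hp.2 ?_⟩
      exact mem_image_of_mem (fun p : G × G => p.1 * p.2⁻¹) (mem_filter.2 ⟨hp.1, hle⟩)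
  · have hBne : B.Nonempty := by
      rw [← card_pos, ← Nat.cast_pos (α := ℝ)]
      exact lt_of_lt_of_le (by positivity) hBlow
    -- The popular mass counts the pairs of `B` whose left quotient is in `S`; averaging over the
    -- first entry gives the translate.
    have h1 : n ^ 2 / M ≤ ∑ a ∈ B, (#{x ∈ B | a⁻¹ * x ∈ S} : ℝ) := by
      refine hS1.trans ?_
      rw [← Nat.cast_sum, ← Nat.cast_sum, sum_card_fiberwise_eq_card_filter]
      refine Nat.cast_le.2 (le_of_eq ?_)
      rw [card_filter, sum_product]
      exact sum_congr rfl fun a _ => (card_filter _ _).symm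
    have h2 : ∑ a ∈ B, n / M ≤ ∑ a ∈ B, (#{x ∈ B | a⁻¹ * x ∈ S} : ℝ) := by
      refine le_trans ?_ h1
      rw [sum_const, nsmul_eq_mul, show n ^ 2 / M = n * (n / M) by ring]
      gcongr
    obtain ⟨a, -, ha⟩ := exists_le_of_sum_le hBne h2
    exact ⟨a, ha.trans (Nat.cast_le.2 (card_le_card (filter_subset_filter _ hBA)))⟩

/-- A set of large energy correlates with a translate of a set of small tripling. -/
theorem exists_small_tripling [Fintype G] (A : Finset G) {n K k M : ℝ} (hn : n = #A)
    (hA : A.Nonempty) (hK : 0 < K) (hk : k = 2 * K) (hM : M = 32 * k ^ 8)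
    (hE : n ^ 3 / K ≤ ∑ x, (#{p ∈ A ×ˢ A | p.1 * p.2⁻¹ = x} : ℝ) ^ 2) :
    ∃ S : Finset G, 1 ∈ S ∧ S⁻¹ = S ∧ (#(S ^ 3) : ℝ) ≤ 512 * M ^ 9 * k ^ 8 * n ∧
      n / M ≤ #S ∧ ∃ a, n / M ≤ #{x ∈ A | a⁻¹ * x ∈ S} := by
  have hn0 : 0 < n := by rw [hn]; exact_mod_cast hA.card_pos
  have hsum : ∑ x, (#{p ∈ A ×ˢ A | p.1 * p.2⁻¹ = x} : ℝ) ≤ n ^ 2 := by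
    rw [hn, ← Nat.cast_sum, sum_card_fiber_prod A fun p => p.1 * p.2⁻¹, Nat.cast_pow]
  obtain ⟨P, hPmem⟩ : ∃ P : Finset G, ∀ x, x ∈ P ↔
      n / (2 * K) ≤ #{p ∈ A ×ˢ A | p.1 * p.2⁻¹ = x} :=
    ⟨univ.filter fun x => n / (2 * K) ≤ #{p ∈ A ×ˢ A | p.1 * p.2⁻¹ = x}, by simp⟩
  have hr : ∀ x, (#{p ∈ A ×ˢ A | p.1 * p.2⁻¹ = x} : ℝ) ≤ n := fun x => by
    rw [hn]; exact Nat.cast_le.2 (card_fiber_mul_inv_le A x)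
  obtain ⟨hP1, hP2⟩ := popular_values _ hn0 hK (fun _ => Nat.cast_nonneg _) hr hsum hE P hPmem
  rw [← hk] at hP1 hP2
  refine exists_small_tripling_of_popular A P hn hA (by rw [hk]; positivity) hM hP2 (hP1.trans ?_)
  rw [← Nat.cast_sum, sum_card_fiberwise_eq_card_filter]

end EnergyToTripling

/-! ### The `ℓ²` flattening lemma -/

section Flattening

open Finset

variable {G : Type*} [Group G]

lemma IsApproxSubgroup.mono {K K' : ℝ} {A : Finset G} (h : IsApproxSubgroup K A) (hK : K ≤ K') :
    IsApproxSubgroup K' A :=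
  ⟨h.one_mem, h.inv_mem, h.exists_cover.imp fun _ hX => ⟨hX.1, hX.2.1.trans hK, hX.2.2⟩⟩

/-- The square of a symmetric set of small tripling is an approximate subgroup. -/
lemma isApproxSubgroup_sq [DecidableEq G] {S : Finset G} {K : ℝ} (h1 : 1 ∈ S) (hS : S⁻¹ = S)
    (hK : (#(S ^ 3) : ℝ) ≤ K * #S) : IsApproxSubgroup (2 * K ^ 3) (S ^ 2) := by
  have h := IsApproximateSubgroup.of_small_tripling h1 hS hK
  obtain ⟨F, hF, hcov⟩ := h.sq_covBySMul
  -- Adding inverses makes the covering set symmetric; hence the factor `2`.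
  refine ⟨one_mem_pow h1, fun a ha => ?_, F ∪ F⁻¹, fun x hx => ?_, ?_, ?_⟩
  · have : (S ^ 2)⁻¹ = S ^ 2 := by rw [← inv_pow, hS]
    rw [← this]
    exact inv_mem_inv ha
  · rw [mem_union, mem_inv'] at hx ⊢
    rw [inv_inv]
    tauto
  · have := card_union_le F F⁻¹
    rw [card_inv] at this
    have : (#(F ∪ F⁻¹) : ℝ) ≤ #F + #F := by exact_mod_cast this
    linarith
  · rw [coe_pow, ← sq]
    refine hcov.trans ?_
    rw [smul_eq_mul]
    exact Set.mul_subset_mul_right (by simp)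

variable [Fintype G]

/-- Cauchy–Schwarz for the five terms into which `ν * ν` splits when `ν` is cut into its middle, low
and high parts. -/
lemma sqNorm_add_five_le {G : Type*} [Fintype G] {f a b c d e : G → ℝ}
    (h : ∀ x, f x = a x + b x + c x + d x + e x) :
    sqNorm f ≤ 5 * (sqNorm a + sqNorm b + sqNorm c + sqNorm d + sqNorm e) := by
  simp only [sqNorm, ← sum_add_distrib, mul_sum]
  refine sum_le_sum fun x _ => ?_
  rw [h]
  nlinarith [sq_nonneg (a x - b x), sq_nonneg (a x - c x), sq_nonneg (a x - d x),
    sq_nonneg (a x - e x), sq_nonneg (b x - c x), sq_nonneg (b x - d x), sq_nonneg (b x - e x),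
    sq_nonneg (c x - d x), sq_nonneg (c x - e x), sq_nonneg (d x - e x)]

/-- If `ν * ν` is not much flatter than `ν`, then so is the convolution square of the restriction
of `ν` to the set where `ν` is comparable to `‖ν‖₂²`. -/
lemma sqNorm_conv_restrict_ge {ν : G → ℝ} (hν : IsSymmProb ν) {T U N : ℝ} (hT : 1 ≤ T)
    (hU : U = 40 * T) (hN : N = sqNorm ν) (h : N / T ≤ sqNorm (conv ν ν)) (A : Finset G)
    [DecidablePred (· ∈ A)] (hA : ∀ x, x ∈ A ↔ N / U ≤ ν x ∧ ν x ≤ U * N) :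
    N / U ≤ sqNorm (conv (fun x => if x ∈ A then ν x else 0) fun x => if x ∈ A then ν x else 0) := by
  classical
  have hN0 : 0 < N := hN ▸ hν.sqNorm_pos
  have hU0 : 0 < U := by linarith
  set f : G → ℝ := fun x => if x ∈ A then ν x else 0 with hf
  let l : G → ℝ := fun x => if ν x < N / U then ν x else 0
  let r : G → ℝ := fun x => if N / U ≤ ν x ∧ U * N < ν x then ν x else 0
  have hdec : ν = f + l + r := by
    funext x
    simp only [Pi.add_apply, hf, l, r, hA]
    by_cases h1 : ν x < N / U
    · simp [h1, not_le.2 h1]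
    · by_cases h2 : ν x ≤ U * N
      · simp [h1, h2, not_lt.1 h1, not_lt.2 h2]
      · simp [h1, h2, not_lt.1 h1, not_le.1 h2]
  have f0 : ∀ x, 0 ≤ f x := fun x => by simp only [hf]; split_ifs <;> simp [hν.nonneg]
  have l0 : ∀ x, 0 ≤ l x := fun x => by simp only [l]; split_ifs <;> simp [hν.nonneg]
  have r0 : ∀ x, 0 ≤ r x := fun x => by simp only [r]; split_ifs <;> simp [hν.nonneg]
  have fν : ∀ x, f x ≤ ν x := fun x => by
    have := congrFun hdec x
    simp only [Pi.add_apply] at this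
    linarith [l0 x, r0 x]
  have sf : ∑ x, f x ≤ 1 := hν.sum_eq_one ▸ sum_le_sum fun x _ => fν x
  have sf0 : 0 ≤ ∑ x, f x := sum_nonneg fun x _ => f0 x
  have nf : sqNorm f ≤ N := hN ▸ sum_le_sum fun x _ => pow_le_pow_left₀ (f0 x) (fν x) 2
  -- The low part is small in `ℓ²` and the high part in `ℓ¹`, so Young's inequality makes every
  -- product involving either of them at most `N / U`.
  have nl : sqNorm l ≤ N / U := by
    calc sqNorm l ≤ ∑ x, N / U * ν x := sum_le_sum fun x _ => by
          simp only [l]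
          split_ifs with hx
          · nlinarith [hν.nonneg x]
          · have := hν.nonneg x
            rw [zero_pow two_ne_zero]
            positivity
      _ = N / U := by rw [← mul_sum, hν.sum_eq_one, mul_one]
  have sr : ∑ x, r x ≤ 1 / U := by
    have h1 : U * N * ∑ x, r x ≤ N := by
      rw [mul_sum, hN, sqNorm]
      refine sum_le_sum fun x _ => ?_
      rw [← sqNorm, ← hN]
      simp only [r]
      split_ifs with hx
      · nlinarith [hν.nonneg x, hx.2]
      · simpa using sq_nonneg (ν x)
    rw [le_div_iff₀ hU0]
    have : N * ((∑ x, r x) * U) ≤ N * 1 := by linarith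
    exact le_of_mul_le_mul_left this hN0
  have sr0 : 0 ≤ ∑ x, r x := sum_nonneg fun x _ => r0 x
  have sr2 : (∑ x, r x) ^ 2 ≤ 1 / U := by
    have : 1 / U ≤ 1 := by rw [div_le_one hU0]; linarith
    nlinarith
  have e1 : sqNorm (conv f l) ≤ N / U := by
    have := sqNorm_conv_le f0 l
    have h2 : (∑ x, f x) ^ 2 ≤ 1 := by nlinarith
    nlinarith [sqNorm_nonneg l]
  have e2 : sqNorm (conv f r) ≤ N / U := by
    refine (sqNorm_conv_le_right f r0).trans ?_
    rw [div_eq_mul_one_div]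
    exact mul_le_mul nf sr2 (sq_nonneg _) hN0.le
  have e3 : sqNorm (conv l ν) ≤ N / U := by
    have := sqNorm_conv_le_right l hν.nonneg
    rw [hν.sum_eq_one] at this
    linarith
  have e4 : sqNorm (conv r ν) ≤ N / U := by
    refine (sqNorm_conv_le r0 ν).trans ?_
    rw [← hN, div_eq_mul_one_div, mul_comm]
    exact mul_le_mul_of_nonneg_left sr2 hN0.le
  have e5 := sqNorm_add_five_le (f := conv ν ν) (a := conv f f) (b := conv f l) (c := conv f r)
    (d := conv l ν) (e := conv r ν) fun x => by
      have h1 : conv ν ν x = conv (f + l + r) ν x := by rw [← hdec]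
      have h2 : conv f ν x = conv f (f + l + r) x := by rw [← hdec]
      rw [h1, add_conv, add_conv, h2, conv_add, conv_add]
  -- With `U = 40 T`, the five-term bound leaves `‖f * f‖₂² ≥ 8 N / U - 4 N / U`.
  have e6 : N / T = 40 * (N / U) := by rw [hU]; field_simp
  linarith [div_pos hN0 hU0]

/-- If `ν * ν` is not much flatter than `ν`, then the set where `ν` is comparable to `‖ν‖₂²` has
large energy. -/
lemma exists_large_energy [DecidableEq G] {ν : G → ℝ} (hν : IsSymmProb ν) {T U N : ℝ}
    (hT : 1 ≤ T) (hU : U = 40 * T) (hN : N = sqNorm ν) (h : N / T ≤ sqNorm (conv ν ν)) :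
    ∃ A : Finset G, (∀ x ∈ A, N / U ≤ ν x) ∧ (#A : ℝ) ≤ U / N ∧ 1 / (U ^ 2 * N) ≤ #A ∧
      (#A : ℝ) ^ 3 / U ^ 8 ≤ ∑ x, (#{p ∈ A ×ˢ A | p.1 * p.2⁻¹ = x} : ℝ) ^ 2 := by
  classical
  have hN0 : 0 < N := hN ▸ hν.sqNorm_pos
  have hU0 : 0 < U := by linarith
  have hU1 : 1 ≤ U := by linarith
  obtain ⟨A, hA⟩ : ∃ A : Finset G, ∀ x, x ∈ A ↔ N / U ≤ ν x ∧ ν x ≤ U * N :=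
    ⟨univ.filter fun x => N / U ≤ ν x ∧ ν x ≤ U * N, by simp⟩
  have hsymm : ∀ x, x⁻¹ ∈ A ↔ x ∈ A := fun x => by rw [hA, hA, hν.symm]
  have hge := sqNorm_conv_restrict_ge hν hT hU hN h A hA
  set R : G → ℝ := fun x => (#{p ∈ A ×ˢ A | p.1 * p.2⁻¹ = x} : ℝ) with hR
  have hR0 : ∀ x, 0 ≤ R x := fun x => Nat.cast_nonneg _
  -- `A` is symmetric because `ν` is, so products of its elements are counted by the quotients `a
  -- b⁻¹`.
  have hind : ∀ x, conv (fun x => if x ∈ A then U * N else 0)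
      (fun x => if x ∈ A then U * N else 0) x = (U * N) ^ 2 * R x := fun g => by
    have e : #{p ∈ A ×ˢ A | p.1 * p.2⁻¹ = g} = #{x : G | x ∈ A ∧ g * x⁻¹ ∈ A} := by
      refine card_bij' (fun p _ => p.2⁻¹) (fun x _ => (g * x⁻¹, x⁻¹)) ?_ ?_ ?_ ?_
      · rintro ⟨a, b⟩ hp
        simp only [mem_filter, mem_product] at hp
        simp [hsymm, hp.1, ← hp.2]
      · intro x hx
        simp only [mem_filter, mem_univ, true_and] at hx
        simp [hsymm, hx]
      · rintro ⟨a, b⟩ hp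
        simp only [mem_filter] at hp
        simp [← hp.2]
      · simp
    have e' : R g = (#{x : G | x ∈ A ∧ g * x⁻¹ ∈ A} : ℝ) := congrArg Nat.cast e
    rw [e', card_filter, Nat.cast_sum, mul_sum, conv]
    refine sum_congr rfl fun x _ => ?_
    by_cases h1 : x ∈ A <;> by_cases h2 : g * x⁻¹ ∈ A <;> simp [h1, h2, sq]
  have hle : sqNorm (conv (fun x => if x ∈ A then ν x else 0)
      fun x => if x ∈ A then ν x else 0) ≤ (U * N) ^ 4 * ∑ x, R x ^ 2 := by
    rw [mul_sum]
    refine sum_le_sum fun x _ => ?_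
    have f0 : ∀ x, 0 ≤ if x ∈ A then ν x else 0 := fun x => by split_ifs <;> simp [hν.nonneg]
    have fle : ∀ x, (if x ∈ A then ν x else 0) ≤ if x ∈ A then U * N else 0 := fun x => by
      split_ifs with hx
      · exact ((hA x).1 hx).2
      · exact le_rfl
    have h1 := conv_mono f0 f0 fle fle x
    rw [hind] at h1
    have h2 := pow_le_pow_left₀ (conv_nonneg f0 f0 x) h1 2
    calc _ ≤ _ := h2
      _ = _ := by ring
  have hEn : 1 / (U ^ 5 * N ^ 3) ≤ ∑ x, R x ^ 2 := by
    have h1 := hge.trans hle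
    have h2 : N / U = (U * N) ^ 4 * (1 / (U ^ 5 * N ^ 3)) := by field_simp
    rw [h2] at h1
    exact le_of_mul_le_mul_left h1 (by positivity)
  have hAle : (#A : ℝ) ≤ U / N := by
    have h1 : (#A : ℝ) * (N / U) ≤ 1 := by
      rw [← nsmul_eq_mul, ← hν.sum_eq_one]
      refine (card_nsmul_le_sum A ν _ fun x hx => ((hA x).1 hx).1).trans ?_
      exact sum_le_sum_of_subset_of_nonneg (subset_univ _) fun x _ _ => hν.nonneg x
    rw [le_div_iff₀ hN0]
    have h2 : (#A : ℝ) * (N / U) * U = #A * N := by field_simp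
    nlinarith
  have hAge : 1 / (U ^ 2 * N) ≤ #A := by
    have h1 : ∑ x, R x ^ 2 ≤ (#A : ℝ) ^ 3 := by
      calc ∑ x, R x ^ 2 ≤ ∑ x, #A * R x := by
            refine sum_le_sum fun x _ => ?_
            have : R x ≤ #A := Nat.cast_le.2 (card_fiber_mul_inv_le A x)
            rw [sq]
            exact mul_le_mul_of_nonneg_right this (hR0 x)
        _ = (#A : ℝ) ^ 3 := by
            rw [← mul_sum, hR, ← Nat.cast_sum, sum_card_fiber_prod A fun p => p.1 * p.2⁻¹]
            push_cast
            ring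
    have h2 : (1 / (U ^ 2 * N)) ^ 3 ≤ (#A : ℝ) ^ 3 := by
      refine le_trans ?_ (hEn.trans h1)
      have h3 : (1 / (U ^ 2 * N)) ^ 3 = 1 / (U ^ 6 * N ^ 3) := by field_simp
      rw [h3]
      have : U ^ 5 ≤ U ^ 6 := pow_le_pow_right₀ hU1 (by norm_num)
      gcongr
    exact le_of_pow_le_pow_left₀ (by norm_num) (Nat.cast_nonneg _) h2
  refine ⟨A, fun x hx => ((hA x).1 hx).1, hAle, hAge, le_trans ?_ hEn⟩
  have h1 : (#A : ℝ) ^ 3 ≤ (U / N) ^ 3 := by gcongr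
  calc (#A : ℝ) ^ 3 / U ^ 8 ≤ (U / N) ^ 3 / U ^ 8 := by gcongr
    _ = 1 / (U ^ 5 * N ^ 3) := by field_simp

/-- If `ν * ν` is not much flatter than `ν`, then `ν` gives large mass to a translate of an
approximate subgroup of size controlled by `‖ν‖₂⁻²`. -/
theorem exists_approxSubgroup {ν : G → ℝ} (hν : IsSymmProb ν) {T U N : ℝ}
    (hT : 1 ≤ T) (hU : U = 40 * T) (hN : N = sqNorm ν) (h : N / T ≤ sqNorm (conv ν ν)) :
    ∃ H : Finset G, IsApproxSubgroup (U ^ 2413) H ∧ (#H : ℝ) * N ≤ U ^ 732 ∧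
      ∃ a, 1 ≤ U ^ 76 * mass ν {x | a⁻¹ * x ∈ H} := by
  classical
  have hN0 : 0 < N := hN ▸ hν.sqNorm_pos
  have hU40 : 40 ≤ U := by linarith
  have hU0 : 0 < U := by linarith
  obtain ⟨A, hA1, hA2, hA3, hE⟩ := exists_large_energy hν hT hU hN h
  have hA : A.Nonempty := by
    rw [← card_pos, ← Nat.cast_pos (α := ℝ)]
    exact lt_of_lt_of_le (by positivity) hA3
  obtain ⟨n, hn⟩ : ∃ n : ℝ, n = #A := ⟨_, rfl⟩
  obtain ⟨k, hk⟩ : ∃ k : ℝ, k = 2 * U ^ 8 := ⟨_, rfl⟩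
  obtain ⟨M, hM⟩ : ∃ M : ℝ, M = 32 * k ^ 8 := ⟨_, rfl⟩
  rw [← hn] at hE hA2 hA3
  have hn0 : 0 < n := lt_of_lt_of_le (by positivity) hA3
  have hk0 : 0 < k := by rw [hk]; positivity
  have hM0 : 0 < M := by rw [hM]; positivity
  have hkU : k ≤ U ^ 9 := by
    rw [hk, pow_succ U 8, mul_comm]
    exact mul_le_mul_of_nonneg_left (by linarith) (by positivity)
  have hMU : M ≤ U ^ 73 := by
    rw [hM, show (73 : ℕ) = 1 + 9 * 8 by norm_num, pow_add, pow_mul, pow_one]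
    exact mul_le_mul (by linarith) (pow_le_pow_left₀ hk0.le hkU 8) (by positivity) hU0.le
  -- All constants become powers of `U ≥ 40`. The tripling constant is then `U ^ (731 + 73)`, whose
  -- doubled cube is at most `U ^ 2413`.
  have hc : 512 * M ^ 9 * k ^ 8 ≤ U ^ 731 := by
    rw [show (731 : ℕ) = 2 + 73 * 9 + 9 * 8 by norm_num, pow_add, pow_add, pow_mul, pow_mul U 9]
    have h1 : (512 : ℝ) ≤ U ^ 2 := by nlinarith
    have h2 := pow_le_pow_left₀ hM0.le hMU 9
    have h3 := pow_le_pow_left₀ hk0.le hkU 8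
    exact mul_le_mul (mul_le_mul h1 h2 (by positivity) (by positivity)) h3 (by positivity)
      (by positivity)
  obtain ⟨S, hS1, hSinv, hS3, hSn, a, ha⟩ :=
    exists_small_tripling A hn hA (by positivity) hk hM hE
  have hS3' : (#(S ^ 3) : ℝ) ≤ U ^ 731 * n :=
    hS3.trans (mul_le_mul_of_nonneg_right hc hn0.le)
  have hnS : n ≤ U ^ 73 * #S := by
    rw [div_le_iff₀ hM0, mul_comm] at hSn
    exact hSn.trans (mul_le_mul_of_nonneg_right hMU (Nat.cast_nonneg _))
  have htrip : (#(S ^ 3) : ℝ) ≤ U ^ 804 * #S := by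
    rw [show (804 : ℕ) = 731 + 73 by norm_num, pow_add, mul_assoc]
    exact hS3'.trans (mul_le_mul_of_nonneg_left hnS (by positivity))
  refine ⟨S ^ 2, (isApproxSubgroup_sq hS1 hSinv htrip).mono ?_, ?_, a, ?_⟩
  · rw [← pow_mul, show (2413 : ℕ) = 804 * 3 + 1 by norm_num, pow_succ, mul_comm]
    exact mul_le_mul_of_nonneg_left (by linarith) (by positivity)
  · have h1 : (#(S ^ 2) : ℝ) ≤ #(S ^ 3) :=
      Nat.cast_le.2 (card_le_card (pow_subset_pow_right hS1 (by norm_num)))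
    rw [le_div_iff₀ hN0] at hA2
    rw [pow_succ]
    calc (#(S ^ 2) : ℝ) * N ≤ U ^ 731 * n * N := by
          exact mul_le_mul_of_nonneg_right (h1.trans hS3') hN0.le
      _ = U ^ 731 * (n * N) := mul_assoc _ _ _
      _ ≤ U ^ 731 * U := mul_le_mul_of_nonneg_left hA2 (by positivity)
  · have h1 : (#{x ∈ A | a⁻¹ * x ∈ S} : ℝ) * (N / U) ≤ mass ν {x | a⁻¹ * x ∈ S ^ 2} := by
      rw [← nsmul_eq_mul]
      refine (card_nsmul_le_sum _ ν _ fun x hx => hA1 x (mem_filter.1 hx).1).trans ?_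
      refine sum_le_sum_of_subset_of_nonneg (fun x hx => ?_) fun x _ _ => hν.nonneg x
      have hx' := (mem_filter.1 hx).2
      have hSS : S ⊆ S ^ 2 := by
        simpa using pow_subset_pow_right hS1 (show 1 ≤ 2 by norm_num)
      simpa using hSS hx'
    have h2 : 1 / (U ^ 2 * N) / U ^ 73 * (N / U) ≤ mass ν {x | a⁻¹ * x ∈ S ^ 2} := by
      refine le_trans ?_ h1
      refine mul_le_mul_of_nonneg_right (le_trans ?_ ha) (by positivity)
      exact div_le_div₀ hn0.le hA3 hM0 hMU
    have h3 : 1 / (U ^ 2 * N) / U ^ 73 * (N / U) * U ^ 76 = 1 := by field_simp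
    rw [← h3, mul_comm]
    exact mul_le_mul_of_nonneg_left h2 (by positivity)

/-- The `ℓ²` flattening alternative. -/
theorem sqNorm_conv_self_le_or {ν : G → ℝ} (hν : IsSymmProb ν) {ε δ κ T : ℝ}
    (hδε : δ ≤ ε) (hεκ : ε ≤ κ) (hclass : ApproxSubgroupClassification G ε δ)
    (hconc : ∀ (L : Subgroup G) (a : G), mass ν {x | a⁻¹ * x ∈ L} ≤ (L.index : ℝ) ^ (-κ))
    (hT : T = (Nat.card G : ℝ) ^ (δ / 5000)) (hT40 : 40 ≤ T) :
    sqNorm (conv ν ν) ≤ sqNorm ν / T ∨ sqNorm ν ≤ (Nat.card G : ℝ) ^ (2 * ε - 1) := by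
  classical
  refine or_iff_not_imp_left.2 fun hnot => ?_
  have hT0 : 0 < T := by linarith
  have hT1 : 1 ≤ T := by linarith
  obtain ⟨U, hU⟩ : ∃ U : ℝ, U = 40 * T := ⟨_, rfl⟩
  have hU0 : 0 < U := by linarith
  -- This uses `T ≥ 40`. The largest exponent needed is then `2 * 2413`, below `5000`, and `T ^ 5000
  -- = |G| ^ δ`.
  have hUT : U ≤ T ^ 2 := by nlinarith
  have hUpow : ∀ m : ℕ, U ^ m ≤ T ^ (2 * m) := fun m => by
    rw [pow_mul]; exact pow_le_pow_left₀ hU0.le hUT m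
  have hG0 : (0 : ℝ) < Nat.card G := Nat.cast_pos.2 Nat.card_pos
  have hG1 : (1 : ℝ) ≤ Nat.card G := Nat.one_le_cast.2 Nat.card_pos
  have hTδ : T ^ 5000 = (Nat.card G : ℝ) ^ δ := by
    rw [hT, ← Real.rpow_natCast, ← Real.rpow_mul hG0.le]
    congr 1
    push_cast
    ring
  obtain ⟨H, hH, hHcard, a, ha⟩ := exists_approxSubgroup hν hT1 hU rfl (not_le.1 hnot).le
  have hH' : IsApproxSubgroup ((Nat.card G : ℝ) ^ δ) H := by
    refine hH.mono ?_
    rw [← hTδ]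
    exact (hUpow _).trans (pow_le_pow_right₀ hT1 (by norm_num))
  rcases hclass H hH' with hbig | ⟨L, Y, hY, hcov⟩
  · have h1 : (Nat.card G : ℝ) ^ (1 - ε) * sqNorm ν ≤ (Nat.card G : ℝ) ^ δ := by
      rw [← hTδ]
      refine (mul_le_mul_of_nonneg_right hbig (sqNorm_nonneg ν)).trans (hHcard.trans ?_)
      exact (hUpow _).trans (pow_le_pow_right₀ hT1 (by norm_num))
    have h2 : (Nat.card G : ℝ) ^ (1 - ε) * sqNorm ν ≤
        (Nat.card G : ℝ) ^ (1 - ε) * (Nat.card G : ℝ) ^ (2 * ε - 1) := by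
      rw [← Real.rpow_add hG0]
      refine h1.trans (Real.rpow_le_rpow_of_exponent_le hG1 (by linarith))
    exact le_of_mul_le_mul_left h2 (by positivity)
  -- The coset cover bounds the mass by `[G : L] ^ (ε - κ) / |G| ^ δ ≤ T ^ (-5000)`, while the
  -- approximate subgroup has a translate of mass at least `T ^ (-152)`.
  · exfalso
    have hidx : (1 : ℝ) ≤ L.index := Nat.one_le_cast.2 (Nat.pos_of_ne_zero L.index_ne_zero_of_finite)
    have h1 : mass ν {x | a⁻¹ * x ∈ H} ≤ ∑ y ∈ Y, mass ν {x | (a * y.out)⁻¹ * x ∈ L} := by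
      unfold mass
      simp only [sum_filter]
      rw [sum_comm]
      refine sum_le_sum fun x _ => ?_
      have hnn : ∀ y ∈ Y, 0 ≤ if x ∈ {x : G | (a * y.out)⁻¹ * x ∈ L} then ν x else 0 :=
        fun y _ => by split_ifs <;> simp [hν.nonneg]
      split_ifs with hx
      · refine le_trans (le_of_eq ?_) (single_le_sum hnn (hcov _ hx))
        rw [if_pos]
        rw [Set.mem_ofPred_eq, mul_inv_rev, mul_assoc, ← QuotientGroup.eq]
        simp
      · exact sum_nonneg hnn
    have h2 : mass ν {x | a⁻¹ * x ∈ H} ≤ #Y * (L.index : ℝ) ^ (-κ) := by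
      rw [← nsmul_eq_mul]
      exact h1.trans (sum_le_card_nsmul _ _ _ fun y _ => hconc L _)
    have h3 : mass ν {x | a⁻¹ * x ∈ H} ≤ 1 / T ^ 5000 := by
      rw [hTδ]
      refine h2.trans ((mul_le_mul_of_nonneg_right hY (by positivity)).trans ?_)
      rw [div_mul_eq_mul_div, ← Real.rpow_add (by linarith)]
      gcongr
      exact Real.rpow_le_one_of_one_le_of_nonpos hidx (by linarith)
    have h4 : 1 ≤ T ^ 152 * (1 / T ^ 5000) :=
      ha.trans (mul_le_mul (hUpow 76) h3
        (sum_nonneg fun x _ => hν.nonneg x) (by positivity))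
    rw [mul_one_div, one_le_div (by positivity)] at h4
    exact absurd h4 (not_le.2 (pow_lt_pow_right₀ (by linarith) (by norm_num)))

end Flattening

/-! ### Non-concentration on cosets and iterated flattening -/

section Escape

variable {G : Type*} [Group G] [Fintype G]

open Classical in
lemma mass_coset (f : G → ℝ) (L : Subgroup G) (x : G) :
    mass f {g | x⁻¹ * g ∈ L} = ∑ l : L, f (x * l) := by
  unfold mass
  refine (Finset.sum_bij' (fun (l : L) _ => x * (l : G))
    (fun g hg => (⟨x⁻¹ * g, by simpa using hg⟩ : L)) ?_ ?_ ?_ ?_ ?_).symm <;> simp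

open Classical in
lemma mass_map_conj (f : G → ℝ) (L : Subgroup G) (x : G) :
    mass f (L.map (MulAut.conj x).toMonoidHom : Subgroup G) = ∑ l : L, f (x * l * x⁻¹) := by
  unfold mass
  refine (Finset.sum_bij (fun (l : L) _ => x * (l : G) * x⁻¹) ?_ ?_ ?_ ?_).symm
  · rintro ⟨l, hl⟩ -
    simp [hl]
  · rintro ⟨l, hl⟩ - ⟨l', hl'⟩ - h
    simpa using h
  · intro g hg
    obtain ⟨l, hl, rfl⟩ : g ∈ L.map (MulAut.conj x).toMonoidHom := by simpa using hg
    exact ⟨⟨l, hl⟩, by simp, by simp⟩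
  · simp

open Classical in
lemma mass_subgroup (f : G → ℝ) (L : Subgroup G) : mass f (L : Set G) = ∑ l : L, f l := by
  have := mass_coset f L 1
  simpa using this

open Classical in
/-- Over a double translate of a subgroup, `ν * ν` integrates to an inner product. -/
lemma card_mul_sum_conv_self {ν : G → ℝ} (hν : ∀ g, ν g⁻¹ = ν g) (L : Subgroup G) (x y : G) :
    (Fintype.card L : ℝ) * ∑ l : L, conv ν ν (x * l * y⁻¹) =
      ∑ g, (∑ l : L, ν (g * l * x⁻¹)) * ∑ l : L, ν (g * l * y⁻¹) := by
  have h1 : ∑ l : L, conv ν ν (x * l * y⁻¹) =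
      ∑ g, ν (g * x⁻¹) * ∑ l : L, ν (g * l * y⁻¹) := by
    simp only [conv_eq_sum_mul_inv_mul, Finset.mul_sum]
    rw [Finset.sum_comm]
    refine Fintype.sum_equiv ((Equiv.inv G).trans (Equiv.mulRight x)) _ _ fun g => ?_
    simp [hν, mul_assoc]
  -- Replacing `g` by `g l` leaves the inner sum over the coset unchanged; summing over `l` then
  -- produces the factor `|L|`.
  have h2 : ∀ l : L, ∑ l : L, conv ν ν (x * l * y⁻¹) =
      ∑ g, ν (g * l * x⁻¹) * ∑ l : L, ν (g * l * y⁻¹) := fun l => by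
    rw [h1]
    refine (Fintype.sum_equiv (Equiv.mulRight (l : G)) _ _ fun g => ?_).symm
    simp only [Equiv.coe_mulRight]
    congr 1
    refine Fintype.sum_equiv (Equiv.mulLeft l⁻¹) _ _ fun m => ?_
    simp [mul_assoc]
  have h3 : ∑ _l : L, ∑ l : L, conv ν ν (x * l * y⁻¹) =
      ∑ g, (∑ l : L, ν (g * l * x⁻¹)) * ∑ l : L, ν (g * l * y⁻¹) := by
    rw [Finset.sum_congr rfl fun l _ => h2 l, Finset.sum_comm]
    exact Finset.sum_congr rfl fun g _ => (Finset.sum_mul _ _ _).symm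
  rw [← h3, Finset.sum_const, nsmul_eq_mul, Finset.card_univ]

/-- The mass of a coset under `ν * ν` is controlled by that of two conjugate subgroups. -/
lemma two_mul_mass_coset_le {ν : G → ℝ} (hν : ∀ g, ν g⁻¹ = ν g) (L : Subgroup G) (x : G) :
    2 * mass (conv ν ν) {g | x⁻¹ * g ∈ L} ≤ mass (conv ν ν) (L : Set G) +
      mass (conv ν ν) (L.map (MulAut.conj x).toMonoidHom : Subgroup G) := by
  classical
  have h1 := card_mul_sum_conv_self hν L x 1
  have h2 := card_mul_sum_conv_self hν L 1 1
  have h3 := card_mul_sum_conv_self hν L x x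
  simp only [inv_one, mul_one, one_mul] at h1 h2
  rw [mass_coset, mass_map_conj, mass_subgroup]
  have hL : (0 : ℝ) < Fintype.card L := Nat.cast_pos.2 Fintype.card_pos
  refine le_of_mul_le_mul_left ?_ hL
  rw [mul_add, mul_left_comm]
  refine (congrArg (2 * ·) h1).trans_le (le_of_le_of_eq ?_ (congrArg₂ (· + ·) h2 h3).symm)
  simp only [Finset.mul_sum (Finset.univ : Finset G), ← Finset.sum_add_distrib]
  exact Finset.sum_le_sum fun g _ => by
    nlinarith [sq_nonneg ((∑ l : L, ν (g * l * x⁻¹)) - ∑ l : L, ν (g * l))]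

/-- Since `n` is even, `μ ^ n` is a convolution square, so its mass on a coset of `L` is at most the
average of its masses on `L` and on a conjugate, which has the same index. For `m ≥ n`, the mass of
a coset under `μ ^ m` is an average of masses of left translates of that coset under `μ ^ n`. -/
lemma mass_convPow_coset_le {μ : G → ℝ} (hμ : IsSymmProb μ) {κ : ℝ} {n m : ℕ} (hn : Even n)
    (h : ∀ H : Subgroup G, mass (convPow μ n) (H : Set G) ≤ (H.index : ℝ) ^ (-κ)) (hnm : n ≤ m)
    (L : Subgroup G) (a : G) :
    mass (convPow μ m) {x | a⁻¹ * x ∈ L} ≤ (L.index : ℝ) ^ (-κ) := by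
  classical
  have base : ∀ a, mass (convPow μ n) {x | a⁻¹ * x ∈ L} ≤ (L.index : ℝ) ^ (-κ) := fun a => by
    obtain ⟨r, rfl⟩ := hn
    have h1 := two_mul_mass_coset_le (hμ.convPow r).symm L a
    rw [← convPow_add] at h1
    have h2 := h L
    have h3 := h (L.map (MulAut.conj a).toMonoidHom)
    rw [Subgroup.index_map_of_bijective (f := (MulAut.conj a).toMonoidHom)
      (MulAut.conj a).bijective] at h3
    linarith
  obtain ⟨r, rfl⟩ := Nat.exists_eq_add_of_le' hnm
  rw [mass_coset, convPow_add]
  simp only [conv_eq_sum_mul_inv_mul]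
  rw [Finset.sum_comm]
  calc ∑ g, ∑ l : L, convPow μ r g * convPow μ n (g⁻¹ * (a * l))
      ≤ ∑ g, convPow μ r g * (L.index : ℝ) ^ (-κ) := Finset.sum_le_sum fun g _ => by
        rw [← Finset.mul_sum]
        refine mul_le_mul_of_nonneg_left ?_ ((hμ.convPow r).nonneg g)
        have := base (g⁻¹ * a)
        rw [mass_coset] at this
        simpa only [mul_assoc] using this
    _ = (L.index : ℝ) ^ (-κ) := by
        rw [← Finset.sum_mul, (hμ.convPow r).sum_eq_one, one_mul]

/-- Iterating the flattening alternative, a moderate power of `μ` is nearly flat. -/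
theorem exists_convPow_flat {μ : G → ℝ} (hμ : IsSymmProb μ) {ε δ κ T : ℝ} (hδε : δ ≤ ε)
    (hεκ : ε ≤ κ) (hclass : ApproxSubgroupClassification G ε δ) (hconc : NonConcentration μ κ)
    (hT : T = (Nat.card G : ℝ) ^ (δ / 5000)) (hT40 : 40 ≤ T) {J : ℕ}
    (hJ : (Nat.card G : ℝ) < T ^ J) :
    ∃ n : ℕ, (n : ℝ) ≤ 2 ^ J * Real.log (Nat.card G) ∧
      sqNorm (convPow μ n) ≤ (Nat.card G : ℝ) ^ (2 * ε - 1) := by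
  obtain ⟨n, hn, hnlog, hmass⟩ := hconc
  by_contra! hcon
  have hT0 : 0 < T := by linarith
  have hlog : 0 ≤ Real.log (Nat.card G) := (Nat.cast_nonneg n).trans hnlog
  -- If no power is flat enough, every squaring gains a factor `T`; after `J` of them `‖·‖₂²` would
  -- fall below `1 / |G|`.
  have key : ∀ j ≤ J, sqNorm (convPow μ (2 ^ j * n)) * T ^ j ≤ 1 := by
    intro j
    induction j with
    | zero => intro _; simpa using (hμ.convPow n).sqNorm_le_one
    | succ j ih =>
      intro hj
      have h1 := ih (by omega)
      have h2 := hcon (2 ^ j * n) (by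
        push_cast
        exact mul_le_mul (pow_le_pow_right₀ one_le_two (by omega)) hnlog (Nat.cast_nonneg n)
          (by positivity))
      have h3 := (sqNorm_conv_self_le_or (hμ.convPow (2 ^ j * n)) hδε hεκ hclass
        (mass_convPow_coset_le hμ hn hmass (Nat.le_mul_of_pos_left n (by positivity))) hT
        hT40).resolve_right (not_le.2 h2)
      rw [← convPow_add, ← two_mul, ← mul_assoc, ← pow_succ', le_div_iff₀ hT0] at h3
      calc sqNorm (convPow μ (2 ^ (j + 1) * n)) * T ^ (j + 1)
          = sqNorm (convPow μ (2 ^ (j + 1) * n)) * T * T ^ j := by ring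
        _ ≤ sqNorm (convPow μ (2 ^ j * n)) * T ^ j :=
            mul_le_mul_of_nonneg_right h3 (by positivity)
        _ ≤ 1 := h1
  have h1 := key J le_rfl
  have h2 := (hμ.convPow (2 ^ J * n)).one_le_card_mul_sqNorm
  have h3 := (hμ.convPow (2 ^ J * n)).sqNorm_pos
  nlinarith

end Escape

/-! ### A polynomial gap for small groups -/

section TrivialGap

variable {G : Type*} [Group G] [Fintype G]

/-- A walk whose `n` steps all lie in `H` ends in `H`. -/
lemma mass_pow_le_mass_convPow {μ : G → ℝ} (hμ : IsSymmProb μ) (H : Subgroup G) (n : ℕ) :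
    mass μ (H : Set G) ^ n ≤ mass (convPow μ n) (H : Set G) := by
  classical
  induction n with
  | zero =>
    rw [pow_zero, mass_subgroup]
    refine le_trans ?_ (Finset.single_le_sum (f := fun l : H => convPow μ 0 l)
      (fun l _ => (hμ.convPow 0).nonneg l)
      (Finset.mem_univ (1 : H)))
    simp [convPow]
  | succ n ih =>
    have h0 : 0 ≤ mass μ (H : Set G) := Finset.sum_nonneg fun x _ => hμ.nonneg x
    rw [pow_succ']
    refine (mul_le_mul_of_nonneg_left ih h0).trans ?_
    rw [mass_subgroup (convPow μ (n + 1)), convPow_succ]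
    simp only [conv_eq_sum_mul_inv_mul]
    rw [Finset.sum_comm]
    have h1 : ∀ x, 0 ≤ ∑ l : H, μ x * convPow μ n (x⁻¹ * l) := fun x =>
      Finset.sum_nonneg fun l _ => mul_nonneg (hμ.nonneg x) ((hμ.convPow n).nonneg _)
    refine le_trans (le_of_eq ?_) (Finset.sum_le_sum_of_subset_of_nonneg
      (Finset.subset_univ (Finset.univ.filter fun x => x ∈ (H : Set G))) fun x _ _ => h1 x)
    rw [mass, Finset.sum_mul]
    refine Finset.sum_congr (by congr) fun x hx => ?_
    have hx : x ∈ H := by simpa using hx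
    rw [← Finset.mul_sum, mass_subgroup]
    congr 1
    refine Fintype.sum_equiv (Equiv.mulLeft (⟨x, hx⟩ : H)) _ _ fun l => ?_
    simp

/-- Under non-concentration, a proper subgroup misses a definite proportion of `μ`. -/
lemma mass_subgroup_le_of_nonConcentration {μ : G → ℝ} (hμ : IsSymmProb μ) {κ : ℝ} (hκ : 0 < κ)
    (hκ1 : κ < 1) (hconc : NonConcentration μ κ) {H : Subgroup G} (hH : H ≠ ⊤) :
    mass μ (H : Set G) ≤ 1 - κ / (3 * Nat.card G) := by
  obtain ⟨n, -, hnlog, hmass⟩ := hconc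
  have hG0 : (0 : ℝ) < Nat.card G := Nat.cast_pos.2 Nat.card_pos
  have hm0 : 0 ≤ mass μ (H : Set G) := Finset.sum_nonneg fun x _ => hμ.nonneg x
  have hnG : (n : ℝ) ≤ Nat.card G :=
    hnlog.trans ((Real.log_le_sub_one_of_pos hG0).trans (by linarith))
  have hidx : (2 : ℝ) ≤ H.index := by
    have h1 : H.index ≠ 1 := mt Subgroup.index_eq_one.1 hH
    have h2 : H.index ≠ 0 := H.index_ne_zero_of_finite
    exact_mod_cast (by omega : 2 ≤ H.index)
  have h1 : (H.index : ℝ) ^ (-κ) ≤ 1 - κ / 3 := by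
    have h2 : 1 + κ / 2 ≤ (H.index : ℝ) ^ κ := by
      refine le_trans ?_ (Real.rpow_le_rpow (by norm_num) hidx hκ.le)
      rw [Real.rpow_def_of_pos (by norm_num)]
      have := Real.add_one_le_exp (Real.log 2 * κ)
      nlinarith [Real.log_two_gt_d9]
    rw [Real.rpow_neg (by linarith)]
    refine (inv_anti₀ (by linarith) h2).trans ?_
    rw [inv_le_iff_one_le_mul₀ (by linarith)]
    nlinarith
  have h2 : mass μ (H : Set G) ^ n ≤ 1 - κ / 3 :=
    (mass_pow_le_mass_convPow hμ H n).trans ((hmass H).trans h1)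
  -- Bernoulli's inequality gives `n (1 - μ(H)) ≥ κ / 3`, and `n ≤ log |G| ≤ |G|`.
  have h3 := one_add_mul_le_pow (a := mass μ (H : Set G) - 1) (by linarith) n
  rw [add_sub_cancel] at h3
  by_contra! hlt
  have h4 : κ / (3 * Nat.card G) * Nat.card G = κ / 3 := by field_simp
  have h5 : 0 < κ / (3 * Nat.card G) := by positivity
  have h6 : n * (1 - mass μ (H : Set G)) < κ / 3 := by
    rw [← h4]
    rcases Nat.eq_zero_or_pos n with rfl | hn
    · simpa using by positivity
    · have hn' : (0 : ℝ) < n := Nat.cast_pos.2 hn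
      nlinarith
  linarith

/-- Increasing sets that stay proper only while they grow exhaust a finite type. -/
lemma eq_univ_of_chain {α : Type*} [Fintype α] (A : ℕ → Finset α) (h0 : (A 0).Nonempty)
    (hmono : ∀ j, A j ⊆ A (j + 1)) (hstep : ∀ j, A j = A (j + 1) → A j = Finset.univ) :
    A (Fintype.card α) = Finset.univ := by
  have key : ∀ j, A j = Finset.univ ∨ j + 1 ≤ (A j).card := by
    intro j
    induction j with
    | zero => exact Or.inr h0.card_pos
    | succ j ih =>
      rcases ih with h | h
      · exact Or.inl (Finset.univ_subset_iff.1 (h ▸ hmono j))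
      · by_cases he : A j = A (j + 1)
        · exact Or.inl (he ▸ hstep j he)
        · have := Finset.card_lt_card ((hmono j).ssubset_of_ne he)
          exact Or.inr (by omega)
  rcases key (Fintype.card α) with h | h
  · exact h
  · exact absurd (Finset.card_le_univ (A (Fintype.card α))) (by omega)

/-- A function that varies by at most `r` along each generator varies by at most `|G| r`. -/
lemma abs_sub_le_of_closure_eq_top {S : Set G} (hS : Subgroup.closure S = ⊤) (f : G → ℝ) {r : ℝ}
    (hr : 0 ≤ r) (h : ∀ s ∈ S, ∀ x, |f (s⁻¹ * x) - f x| ≤ r) (x y : G) :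
    |f y - f x| ≤ Nat.card G * r := by
  classical
  -- If `A j = A (j + 1)`, then `A j` contains `1` and is stable under right multiplication by `S`,
  -- so it is all of `G`: in a finite group `S` generates even as a monoid.
  let A : ℕ → Finset G := fun j => Finset.univ.filter fun g => ∀ x, |f (g⁻¹ * x) - f x| ≤ j * r
  have hA : A (Fintype.card G) = Finset.univ := by
    refine eq_univ_of_chain A ⟨1, by simp [A]⟩ (fun j g hg => ?_) fun j hj => ?_
    · simp only [A, Finset.mem_filter, Finset.mem_univ, true_and] at hg ⊢
      exact fun x => (hg x).trans (by push_cast; nlinarith)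
    · have hmul : ∀ s ∈ S, ∀ g ∈ A j, g * s ∈ A j := by
        intro s hs g hg
        rw [hj]
        simp only [A, Finset.mem_filter, Finset.mem_univ, true_and] at hg ⊢
        intro x
        have h1 := hg x
        have h2 := h s hs (g⁻¹ * x)
        rw [mul_inv_rev, mul_assoc]
        have h3 := abs_sub_le (f (s⁻¹ * (g⁻¹ * x))) (f (g⁻¹ * x)) (f x)
        push_cast
        linarith
      have hone : (1 : G) ∈ A j := by simp [A]; positivity
      refine Finset.eq_univ_iff_forall.2 fun g => ?_
      have hmon : Submonoid.closure S = ⊤ := by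
        have := Subgroup.closure_toSubmonoid_of_finite (s := S)
        rw [← this, hS]; rfl
      have hg : g ∈ Submonoid.closure S := hmon ▸ Submonoid.mem_top g
      induction hg using Submonoid.closure_induction_right with
      | one => exact hone
      | mul_right g _ s hs ih => exact hmul s hs g ih
  have hmem : x * y⁻¹ ∈ A (Fintype.card G) := hA ▸ Finset.mem_univ _
  simp only [A, Finset.mem_filter, Finset.mem_univ, true_and] at hmem
  have := hmem x
  rw [Nat.card_eq_fintype_card]
  simpa using this

/-- The Dirichlet form of an eigenfunction. -/
lemma sum_dirichlet_eq {μ f : G → ℝ} (hμ : IsSymmProb μ) {t : ℝ} (hf : conv μ f = (1 - t) • f) :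
    ∑ g, μ g * ∑ x, (f (g⁻¹ * x) - f x) ^ 2 = 2 * t * sqNorm f := by
  have h1 : ∀ g, ∑ x, (f (g⁻¹ * x) - f x) ^ 2 = 2 * sqNorm f - 2 * ∑ x, f (g⁻¹ * x) * f x := by
    intro g
    have e : ∑ x, f (g⁻¹ * x) ^ 2 = sqNorm f :=
      Fintype.sum_equiv (Equiv.mulLeft g⁻¹) _ _ fun x => rfl
    have : ∀ x, (f (g⁻¹ * x) - f x) ^ 2 = f (g⁻¹ * x) ^ 2 + f x ^ 2 - 2 * (f (g⁻¹ * x) * f x) :=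
      fun x => by ring
    simp only [this, Finset.sum_sub_distrib, Finset.sum_add_distrib, e, ← Finset.mul_sum]
    rw [sqNorm]; ring
  have h2 : ∑ g, μ g * ∑ x, f (g⁻¹ * x) * f x = (1 - t) * sqNorm f := by
    simp only [Finset.mul_sum, sqNorm]
    rw [Finset.sum_comm]
    refine Finset.sum_congr rfl fun x _ => ?_
    have := congrFun hf x
    rw [conv_eq_sum_mul_inv_mul, Pi.smul_apply, smul_eq_mul] at this
    rw [sq, ← mul_assoc, ← this, Finset.sum_mul]
    exact Finset.sum_congr rfl fun g _ => by ring
  simp only [h1, mul_sub, Finset.sum_sub_distrib, ← Finset.sum_mul, hμ.sum_eq_one, one_mul]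
  simp only [mul_left_comm _ (2 : ℝ), ← Finset.mul_sum] at h2 ⊢
  rw [h2]
  ring

/-- A polynomial lower bound for the spectral gap, effective when `G` is small. -/
theorem gap_ge_of_nonConcentration {μ f : G → ℝ} (hμ : IsSymmProb μ) {κ t : ℝ}
    (hκ : 0 < κ) (hκ1 : κ < 1) (hconc : NonConcentration μ κ) (hf0 : f ≠ 0) (ht : t ≠ 0)
    (hf : conv μ f = (1 - t) • f) : κ / (6 * (Nat.card G : ℝ) ^ 5) ≤ t := by
  classical
  have hG0 : (0 : ℝ) < Nat.card G := Nat.cast_pos.2 Nat.card_pos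
  -- Elements of mass at least `c` generate `G`: otherwise the complement of the subgroup they
  -- generate would have mass below `|G| c = κ / (3 |G|)`, against non-concentration.
  obtain ⟨c, hc⟩ : ∃ c : ℝ, c = κ / (3 * (Nat.card G : ℝ) ^ 2) := ⟨_, rfl⟩
  have hc0 : 0 < c := by rw [hc]; positivity
  let S : Set G := {g | c ≤ μ g}
  have hS : Subgroup.closure S = ⊤ := by
    by_contra hne
    have h1 := mass_subgroup_le_of_nonConcentration hμ hκ hκ1 hconc hne
    set H := Subgroup.closure S with hH
    have h2 : ∑ x with x ∉ (H : Set G), μ x < Nat.card G * c := by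
      have hne' : (Finset.univ.filter fun x => x ∉ (H : Set G)).Nonempty := by
        by_contra hemp
        rw [Finset.not_nonempty_iff_eq_empty, Finset.filter_eq_empty_iff] at hemp
        exact hne (eq_top_iff.2 fun x _ => not_not.1 (hemp (Finset.mem_univ x)))
      calc ∑ x with x ∉ (H : Set G), μ x < ∑ x with x ∉ (H : Set G), c := by
            refine Finset.sum_lt_sum_of_nonempty hne' fun x hx => ?_
            refine lt_of_not_ge fun hle => (Finset.mem_filter.1 hx).2 ?_
            exact Subgroup.subset_closure hle
        _ ≤ Nat.card G * c := by
            rw [Finset.sum_const, nsmul_eq_mul, Nat.card_eq_fintype_card]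
            gcongr
            exact Finset.card_le_univ _
    have h3 : mass μ (H : Set G) + ∑ x with x ∉ (H : Set G), μ x = 1 := by
      rw [← hμ.sum_eq_one, mass]
      convert Finset.sum_filter_add_sum_filter_not Finset.univ (fun x => x ∈ (H : Set G)) μ
    have h4 : Nat.card G * c = κ / (3 * Nat.card G) := by rw [hc]; field_simp
    linarith
  have hnf : 0 < sqNorm f := by
    refine (sqNorm_nonneg f).lt_of_ne' fun h => hf0 ?_
    funext x
    exact pow_eq_zero_iff two_ne_zero |>.1
      ((Finset.sum_eq_zero_iff_of_nonneg fun x _ => sq_nonneg (f x)).1 h x (Finset.mem_univ x))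
  have hD : ∀ s ∈ S, ∀ x, (f (s⁻¹ * x) - f x) ^ 2 ≤ 2 * t * sqNorm f / c := by
    intro s hs x
    rw [le_div_iff₀ hc0, ← sum_dirichlet_eq hμ hf, mul_comm]
    have h1 : (f (s⁻¹ * x) - f x) ^ 2 ≤ ∑ x, (f (s⁻¹ * x) - f x) ^ 2 :=
      Finset.single_le_sum (f := fun x => (f (s⁻¹ * x) - f x) ^ 2)
        (fun _ _ => sq_nonneg _) (Finset.mem_univ x)
    refine (mul_le_mul hs h1 (sq_nonneg _) (hμ.nonneg s)).trans ?_
    exact Finset.single_le_sum (f := fun g => μ g * ∑ x, (f (g⁻¹ * x) - f x) ^ 2)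
      (fun g _ => mul_nonneg (hμ.nonneg g) (Finset.sum_nonneg fun _ _ => sq_nonneg _))
      (Finset.mem_univ s)
  have ht0 : 0 ≤ 2 * t * sqNorm f := by
    rw [← sum_dirichlet_eq hμ hf]
    exact Finset.sum_nonneg fun g _ =>
      mul_nonneg (hμ.nonneg g) (Finset.sum_nonneg fun _ _ => sq_nonneg _)
  have hosc := abs_sub_le_of_closure_eq_top hS f (Real.sqrt_nonneg (2 * t * sqNorm f / c))
    fun s hs x => Real.abs_le_sqrt (hD s hs x)
  -- Since `t ≠ 0`, `f` has mean zero, so its oscillation bounds its size.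
  have hmean : ∑ x, f x = 0 := by
    have h1 := sum_conv μ f
    rw [hf, hμ.sum_eq_one, one_mul] at h1
    simp only [Pi.smul_apply, smul_eq_mul, ← Finset.mul_sum] at h1
    have : t * ∑ x, f x = 0 := by linarith
    exact (mul_eq_zero.1 this).resolve_left ht
  have hpt : ∀ x, f x ^ 2 ≤ (Nat.card G : ℝ) ^ 2 * (2 * t * sqNorm f / c) := by
    intro x
    have h1 : (Nat.card G : ℝ) * f x = ∑ y, (f x - f y) := by
      rw [Finset.sum_sub_distrib, hmean, sub_zero, Finset.sum_const, nsmul_eq_mul,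
        Finset.card_univ, Nat.card_eq_fintype_card]
    have h2 : (Nat.card G : ℝ) * |f x| ≤
        Nat.card G * (Nat.card G * Real.sqrt (2 * t * sqNorm f / c)) := by
      rw [← abs_of_pos hG0, ← abs_mul, abs_of_pos hG0, h1]
      refine (Finset.abs_sum_le_sum_abs _ _).trans ?_
      refine (Finset.sum_le_card_nsmul _ _ _ fun y _ => hosc y x).trans (le_of_eq ?_)
      rw [nsmul_eq_mul, Finset.card_univ, Nat.card_eq_fintype_card]
    have h3 := le_of_mul_le_mul_left h2 hG0
    rw [← sq_abs]
    refine (pow_le_pow_left₀ (abs_nonneg _) h3 2).trans (le_of_eq ?_)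
    rw [mul_pow, Real.sq_sqrt (by positivity)]
  have hfin : sqNorm f ≤ Nat.card G * ((Nat.card G : ℝ) ^ 2 * (2 * t * sqNorm f / c)) := by
    refine (Finset.sum_le_card_nsmul _ _ _ fun x _ => hpt x).trans (le_of_eq ?_)
    rw [nsmul_eq_mul, Finset.card_univ, Nat.card_eq_fintype_card]
  have e1 : (Nat.card G : ℝ) * ((Nat.card G : ℝ) ^ 2 * (2 * t * sqNorm f / c)) =
      sqNorm f * (t / (κ / (6 * (Nat.card G : ℝ) ^ 5))) := by
    rw [hc]; field_simp; ring
  rw [e1] at hfin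
  have h1 : sqNorm f * 1 ≤ sqNorm f * (t / (κ / (6 * (Nat.card G : ℝ) ^ 5))) := by linarith
  have h2 := le_of_mul_le_mul_left h1 hnf
  rwa [le_div_iff₀ (by positivity), one_mul] at h2

end TrivialGap

/-! ### Trace bound and the Laplacian as convolution -/

section Spectral

variable {G : Type*} [Group G] [Fintype G]

/-- The trace bound: an eigenvalue `α` of multiplicity `d` of convolution by `μ` satisfies
`d α ^ (2 n) ≤ |G| ‖μ ^ n‖₂²`. -/
theorem finrank_mul_pow_le {μ : G → ℝ} {α : ℝ} (W : Submodule ℝ (G → ℝ))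
    (hW : ∀ f ∈ W, conv μ f = α • f) (n : ℕ) :
    (Module.finrank ℝ W : ℝ) * α ^ (2 * n) ≤ Nat.card G * sqNorm (convPow μ n) := by
  classical
  let e : EuclideanSpace ℝ G ≃ₗ[ℝ] (G → ℝ) := WithLp.linearEquiv 2 ℝ (G → ℝ)
  let W' : Submodule ℝ (EuclideanSpace ℝ G) := W.comap e.toLinearMap
  have hdim : Module.finrank ℝ W' = Module.finrank ℝ W :=
    (e.submoduleMap W').finrank_eq.trans (by
      rw [show W'.map (e : EuclideanSpace ℝ G →ₗ[ℝ] (G → ℝ)) = W from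
        Submodule.map_comap_eq_of_surjective e.surjective W])
  let b := stdOrthonormalBasis ℝ W'
  let v : Fin (Module.finrank ℝ W') → EuclideanSpace ℝ G := fun i => (b i : EuclideanSpace ℝ G)
  have hv : Orthonormal ℝ v := b.orthonormal.comp_linearIsometry W'.subtypeₗᵢ
  -- The inner product of `v i` with row `x` of the kernel of `μ ^ n` is `α ^ n * v i x`; Bessel's
  -- inequality bounds the sum of the squares by the norm of that row.
  have hrow : ∀ x : G, ∑ i, (α ^ n * v i x) ^ 2 ≤ sqNorm (convPow μ n) := by
    intro x
    let k : EuclideanSpace ℝ G := WithLp.toLp 2 fun y => convPow μ n (x * y⁻¹)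
    have h1 := hv.sum_inner_products_le k (s := Finset.univ)
    have h2 : ‖k‖ ^ 2 = sqNorm (convPow μ n) := by
      rw [EuclideanSpace.norm_sq_eq]
      refine Fintype.sum_equiv ((Equiv.inv G).trans (Equiv.mulLeft x)) _ _ fun y => ?_
      simp [k]
    rw [h2] at h1
    refine le_trans (Finset.sum_le_sum fun i _ => le_of_eq ?_) h1
    have h3 : conv (convPow μ n) (v i).ofLp x = α ^ n * v i x :=
      congrFun (convPow_apply_eigenvector (hW _ (b i).2) n) x
    rw [← h3, Real.norm_eq_abs, sq_abs]
    simp [PiLp.inner_apply, k, conv]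
  have hcol : ∀ i, ∑ x, v i x ^ 2 = 1 := fun i => by
    have := EuclideanSpace.norm_sq_eq (v i)
    rw [hv.1 i] at this
    simpa using this.symm
  calc (Module.finrank ℝ W : ℝ) * α ^ (2 * n)
      = ∑ i, ∑ x, (α ^ n * v i x) ^ 2 := by
        simp only [mul_pow, ← Finset.mul_sum, hcol, mul_one, Finset.sum_const, Finset.card_univ,
          Fintype.card_fin, nsmul_eq_mul, hdim]
        rw [← pow_mul, mul_comm n 2]
    _ = ∑ x, ∑ i, (α ^ n * v i x) ^ 2 := Finset.sum_comm
    _ ≤ ∑ _x : G, sqNorm (convPow μ n) := Finset.sum_le_sum fun x _ => hrow x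
    _ = Nat.card G * sqNorm (convPow μ n) := by
        rw [Finset.sum_const, nsmul_eq_mul, Finset.card_univ, Nat.card_eq_fintype_card]

lemma laplacian_apply {G : Type*} [Group G] (S : Finset G) (f : G → ℝ) (x : G) :
    laplacian S f x = f x - (S.card : ℝ)⁻¹ * ∑ s ∈ S, f (s⁻¹ * x) := rfl

/-- The Laplace operator is `f - μ * f`, also after passing to a quotient. -/
lemma laplacian_comp_eq {G' : Type*} [Group G'] [Fintype G'] (π : G →* G') (S : Finset G)
    (h : G' → ℝ) :
    laplacian S (h ∘ π) = (h - conv (pushforward π (uniformMeasure S)) h) ∘ π := by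
  classical
  funext x
  rw [laplacian_apply]
  simp only [Function.comp_apply, Pi.sub_apply, map_mul, map_inv]
  congr 1
  rw [conv_eq_sum_mul_inv_mul]
  simp only [pushforward, Finset.sum_mul, Finset.sum_filter]
  rw [Finset.sum_comm]
  simp only [uniformMeasure, ite_mul, zero_mul, Finset.sum_ite_eq, Finset.mem_univ, if_true]
  rw [Finset.mul_sum, ← Finset.sum_filter]
  exact Finset.sum_congr (by ext; simp) fun _ _ => rfl

lemma isSymmProb_pushforward {G' : Type*} [Group G'] [Fintype G'] (π : G →* G') {S : Finset G}
    (hS : ∀ s ∈ S, s⁻¹ ∈ S) (hne : S.Nonempty) :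
    IsSymmProb (pushforward π (uniformMeasure S)) := by
  classical
  have hc : (S.card : ℝ) ≠ 0 := Nat.cast_ne_zero.2 hne.card_pos.ne'
  refine ⟨fun y => Finset.sum_nonneg fun x _ => ?_, ?_, fun y => ?_⟩
  · unfold uniformMeasure
    split_ifs
    · positivity
    · exact le_rfl
  · have h1 : ∑ y, ∑ x with π x = y, uniformMeasure S x = ∑ x, uniformMeasure S x :=
      Finset.sum_fiberwise Finset.univ π _
    have h2 : ∑ x, uniformMeasure S x = 1 := by
      simp only [uniformMeasure]
      rw [← Finset.sum_filter, Finset.sum_const, nsmul_eq_mul,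
        show (Finset.univ.filter fun g => g ∈ S) = S by ext; simp, mul_inv_cancel₀ hc]
    convert h1.trans h2 using 2
    simp only [pushforward]
  · unfold pushforward
    refine Finset.sum_bij' (fun x _ => x⁻¹) (fun x _ => x⁻¹) ?_ ?_ ?_ ?_ ?_
    · intro x hx; simpa [inv_eq_iff_eq_inv] using hx
    · intro x hx; simpa [inv_eq_iff_eq_inv] using hx
    · simp
    · simp
    · intro x _
      have : x⁻¹ ∈ S ↔ x ∈ S := ⟨fun h => by simpa using hS _ h, hS x⟩
      simp [uniformMeasure, this]

/-- A generating set of a nontrivial group has a Laplace operator with a nonzero eigenvalue. -/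
lemma exists_laplacian_eigenvalue_ne_zero [Nontrivial G] {S : Finset G}
    (hS : ∀ s ∈ S, s⁻¹ ∈ S) (hgen : Subgroup.closure (S : Set G) = ⊤) :
    ∃ t : ℝ, t ≠ 0 ∧ (laplacian S).HasEigenvalue t := by
  classical
  let A : Matrix G G ℝ := fun x y => (if x = y then 1 else 0) -
    (S.card : ℝ)⁻¹ * if x * y⁻¹ ∈ S then 1 else 0
  have hA : A.IsHermitian := by
    ext x y
    have : y * x⁻¹ ∈ S ↔ x * y⁻¹ ∈ S :=
      ⟨fun h => by simpa using hS _ h, fun h => by simpa using hS _ h⟩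
    rw [Matrix.conjTranspose_apply]
    simp [A, this, eq_comm]
  have hmul : ∀ f : G → ℝ, A.mulVec f = laplacian S f := fun f => by
    funext x
    rw [laplacian_apply]
    simp only [Matrix.mulVec, dotProduct, A, sub_mul, Finset.sum_sub_distrib, ite_mul, one_mul,
      zero_mul, Finset.sum_ite_eq, Finset.mem_univ, if_true, mul_assoc]
    rw [← Finset.mul_sum, ← Finset.sum_filter]
    congr 2
    refine Finset.sum_bij' (fun y _ => x * y⁻¹) (fun s _ => s⁻¹ * x) ?_ ?_ ?_ ?_ ?_ <;> simp
  -- A nonzero Hermitian matrix has a nonzero eigenvalue. Some `s ∈ S` differs from `1`, and the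
  -- entry of `A` at `(s, 1)` is `-1 / |S|`.
  have hne : A ≠ 0 := by
    intro h0
    have hsub : (S : Set G) ⊆ (⊥ : Subgroup G) := by
      intro s hs
      by_contra hs1
      have hs1 : s ≠ 1 := by simpa using hs1
      have h1 := congrFun (congrFun h0 s) 1
      have hc : (S.card : ℝ) ≠ 0 := Nat.cast_ne_zero.2 (Finset.card_pos.2 ⟨s, hs⟩).ne'
      have hs' : s ∈ S := hs
      simp [A, hs1, hs'] at h1
      exact hc (by exact_mod_cast congrArg Finset.card h1)
    exact bot_ne_top (eq_top_iff.2 (hgen ▸ (Subgroup.closure_le _).2 hsub))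
  have hev : hA.eigenvalues ≠ 0 := mt hA.eigenvalues_eq_zero_iff.1 hne
  obtain ⟨i, hi⟩ := Function.ne_iff.1 hev
  refine ⟨hA.eigenvalues i, hi, Module.End.hasEigenvalue_of_hasEigenvector
    (x := (hA.eigenvectorBasis i).ofLp) ⟨?_, ?_⟩⟩
  · rw [Module.End.mem_eigenspace_iff, ← hmul, hA.mulVec_eigenvectorBasis]
  · intro h0
    have h1 : hA.eigenvectorBasis i = 0 := by
      ext x; exact congrFun h0 x
    exact hA.eigenvectorBasis.toBasis.ne_zero i (by simpa using h1)

end Spectral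

/-! ### Descent of eigenspaces to quotients -/

section Transfer

variable {G : Type*} [Group G] [Fintype G]

/-- Right translation acting on an eigenspace of the Laplace operator. -/
def eigenspaceRep (S : Finset G) (t : ℝ) :
    G →* Module.End ℝ ((laplacian S).eigenspace t) where
  toFun g :=
    { toFun := fun f => ⟨fun x => f.1 (x * g), by
        have hf := Module.End.mem_eigenspace_iff.1 f.2
        rw [Module.End.mem_eigenspace_iff]
        funext x
        have := congrFun hf (x * g)
        simpa [laplacian_apply, mul_assoc] using this⟩
      map_add' := fun _ _ => rfl
      map_smul' := fun _ _ => rfl }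
  map_one' := by ext; simp
  map_mul' g h := by ext; simp [mul_assoc]

lemma eigenspaceRep_apply {G : Type*} [Group G] (S : Finset G) (t : ℝ) (g : G) (f : (laplacian S).eigenspace t) (x : G) :
    (eigenspaceRep S t g f : G → ℝ) x = (f : G → ℝ) (x * g) := rfl

/-- A finite-dimensional real representation factors to a complex matrix representation of the
quotient by its kernel. -/
lemma card_rpow_le_finrank {G V : Type*} [Group G] [AddCommGroup V] [Module ℝ V]
    [FiniteDimensional ℝ V] (ρ : G →* Module.End ℝ V) {N : Subgroup G} [N.Normal] (hN : N = ρ.ker) {β : ℝ}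
    (hβ : HighMultiplicity (G ⧸ N) β) (hV : 0 < Module.finrank ℝ V) :
    (Nat.card (G ⧸ N) : ℝ) ^ β ≤ Module.finrank ℝ V := by
  let ρ' : G ⧸ N →* Module.End ℝ V := QuotientGroup.lift N ρ fun x hx => by
    rwa [hN] at hx
  have hρ' : Function.Injective ρ' := by
    rw [injective_iff_map_eq_one]
    intro x
    induction x using QuotientGroup.induction_on with
    | H x =>
      intro hx
      rw [QuotientGroup.eq_one_iff, hN]
      exact hx
  let b := Module.finBasis ℝ V
  let φ : Module.End ℝ V →* Matrix (Fin (Module.finrank ℝ V)) (Fin (Module.finrank ℝ V)) ℂ :=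
    (Complex.ofRealHom.mapMatrix : Matrix (Fin (Module.finrank ℝ V))
      (Fin (Module.finrank ℝ V)) ℝ →+* _).toMonoidHom.comp
      (LinearMap.toMatrixAlgEquiv b).toMulEquiv.toMonoidHom
  have hφ : Function.Injective φ :=
    (Matrix.map_injective Complex.ofReal_injective).comp (LinearMap.toMatrixAlgEquiv b).injective
  refine hβ _ hV (φ.comp ρ').toHomUnits fun x y hxy => hρ' (hφ ?_)
  exact congrArg Units.val hxy

/-- Every nonzero eigenvalue of the Laplace operator lives, with large multiplicity, on a
nontrivial quotient. -/
theorem exists_quotient_eigenspace {S : Finset G} (hS : S.Nonempty) {t β : ℝ} (ht : t ≠ 0)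
    (hev : (laplacian S).HasEigenvalue t)
    (hβ : ∀ (N : Subgroup G) [N.Normal], HighMultiplicity (G ⧸ N) β) :
    ∃ (N : Subgroup G) (_ : N.Normal) (_ : Fintype (G ⧸ N)) (W : Submodule ℝ (G ⧸ N → ℝ)),
      N ≠ ⊤ ∧ W ≠ ⊥ ∧ (Nat.card (G ⧸ N) : ℝ) ^ β ≤ Module.finrank ℝ W ∧
      ∀ f ∈ W, conv (pushforward (QuotientGroup.mk' N) (uniformMeasure S)) f = (1 - t) • f := by
  classical
  let V := (laplacian S).eigenspace t
  let N := (eigenspaceRep S t).ker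
  let _ : Fintype (G ⧸ N) := Fintype.ofFinite _
  have hVne : V ≠ ⊥ := hev
  have hVpos : 0 < Module.finrank ℝ V := by
    have := Submodule.nontrivial_iff_ne_bot.2 hVne
    exact Module.finrank_pos
  have hinv : ∀ f ∈ V, ∀ x, ∀ g ∈ N, f (x * g) = f x := fun f hf x g hg => by
    have h1 : eigenspaceRep S t g = 1 := hg
    have h2 := eigenspaceRep_apply S t g ⟨f, hf⟩ x
    rw [h1] at h2
    exact h2.symm
  let pull : (G ⧸ N → ℝ) →ₗ[ℝ] (G → ℝ) := LinearMap.funLeft ℝ ℝ (QuotientGroup.mk' N)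
  have hpull : Function.Injective pull :=
    LinearMap.funLeft_injective_of_surjective ℝ ℝ _ (QuotientGroup.mk'_surjective N)
  have hrange : V ≤ LinearMap.range pull := by
    intro f hf
    refine ⟨Quotient.lift f fun x y hxy => ?_, ?_⟩
    · have hxy' : x⁻¹ * y ∈ N := QuotientGroup.leftRel_apply.1 hxy
      have := hinv f hf x _ hxy'
      simpa using this.symm
    · funext x; rfl
  let W : Submodule ℝ (G ⧸ N → ℝ) := V.comap pull
  have hWV : W.map pull = V := by rw [Submodule.map_comap_eq, inf_eq_right.2 hrange]
  have hdim : Module.finrank ℝ W = Module.finrank ℝ V := by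
    rw [← hWV]
    exact (Submodule.equivMapOfInjective pull hpull W).finrank_eq
  refine ⟨N, inferInstance, inferInstance, W, ?_, ?_, ?_, ?_⟩
  -- If all of `G` acted trivially, the eigenfunctions would be constant, which forces `t = 0`.
  · intro htop
    obtain ⟨f, hf, hf0⟩ := Submodule.exists_mem_ne_zero_of_ne_bot hVne
    have hconst : ∀ x, f x = f 1 := fun x => by
      simpa using hinv f hf 1 x (htop ▸ Subgroup.mem_top x)
    have h1 := Module.End.mem_eigenspace_iff.1 hf
    have hc : (S.card : ℝ) ≠ 0 := Nat.cast_ne_zero.2 hS.card_pos.ne'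
    have h2 : t * f 1 = 0 := by
      have := congrFun h1 1
      rw [laplacian_apply, Finset.sum_congr rfl fun s _ => hconst _, Finset.sum_const,
        nsmul_eq_mul, inv_mul_cancel_left₀ hc, sub_self] at this
      simpa using this.symm
    refine hf0 (funext fun x => ?_)
    rw [hconst]
    exact (mul_eq_zero.1 h2).resolve_left ht
  · rintro hbot
    rw [hbot, Submodule.map_bot] at hWV
    exact hVne hWV.symm
  · rw [hdim]
    exact card_rpow_le_finrank (eigenspaceRep S t) rfl (hβ N) hVpos
  · intro f hf
    have h1 : laplacian S (f ∘ QuotientGroup.mk' N) = t • (f ∘ QuotientGroup.mk' N) :=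
      Module.End.mem_eigenspace_iff.1 hf
    rw [laplacian_comp_eq] at h1
    funext y
    obtain ⟨x, rfl⟩ := QuotientGroup.mk'_surjective N y
    have := congrFun h1 x
    simp only [Function.comp_apply, Pi.sub_apply, Pi.smul_apply, smul_eq_mul] at this ⊢
    linarith

end Transfer

/-! ### The spectral gap on small and large quotients -/

section Gap

variable {G : Type*} [Group G] [Fintype G]

/-- The gap on a small group. -/
lemma gap_ge_of_small {μ f : G → ℝ} (hμ : IsSymmProb μ) {κ d t : ℝ} (hκ1 : κ < 1) (hd : 0 < d)
    (hdκ : d ≤ κ) (hconc : NonConcentration μ κ) (hf0 : f ≠ 0) (ht : t ≠ 0)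
    (hf : conv μ f = (1 - t) • f) (hsmall : (Nat.card G : ℝ) ^ (d / 5000) ≤ 40) :
    Real.exp (-(1000010 / d)) ≤ t := by
  have hG0 : (0 : ℝ) < Nat.card G := Nat.cast_pos.2 Nat.card_pos
  refine le_trans ?_ (gap_ge_of_nonConcentration hμ (hd.trans_le hdκ) hκ1 hconc hf0 ht hf)
  -- `log 40 ≤ 39` and `5000 * 39 ≤ 200000`. The fifth power costs `1000000 / d`, and the factor `6
  -- / κ` a further `10 / d`.
  have h1 : Real.log (Nat.card G) ≤ 200000 / d := by
    have h2 := Real.log_le_log (by positivity) hsmall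
    rw [Real.log_rpow hG0] at h2
    have h3 := Real.log_le_sub_one_of_pos (show (0 : ℝ) < 40 by norm_num)
    rw [le_div_iff₀ hd]
    linarith
  have h2 : (Nat.card G : ℝ) ^ 5 ≤ Real.exp (1000000 / d) := by
    rw [← Real.exp_log hG0, ← Real.exp_nat_mul, Real.exp_le_exp]
    have : (1000000 : ℝ) / d = 5 * (200000 / d) := by ring
    push_cast
    linarith
  have h3 : 6 / d ≤ Real.exp (10 / d) := by
    have := Real.add_one_le_exp (10 / d)
    have h4 : 6 / d ≤ 10 / d := by gcongr; norm_num
    linarith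
  have h4 : Real.exp (-(1000010 / d)) = (Real.exp (10 / d) * Real.exp (1000000 / d))⁻¹ := by
    rw [← Real.exp_add, ← Real.exp_neg]
    congr 1
    ring
  have h5 : κ / (6 * (Nat.card G : ℝ) ^ 5) = (6 / κ * (Nat.card G : ℝ) ^ 5)⁻¹ := by
    have := hd.trans_le hdκ
    field_simp
  rw [h4, h5]
  have h6 : 0 < 6 / κ := div_pos (by norm_num) (hd.trans_le hdκ)
  have h7 : 6 / κ ≤ 6 / d := by gcongr
  have h8 : 0 < 6 / κ * (Nat.card G : ℝ) ^ 5 := by positivity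
  gcongr
  exact h7.trans h3

/-- The gap on a large group. -/
lemma gap_ge_of_large {μ : G → ℝ} (hμ : IsSymmProb μ) {β κ ε d t : ℝ} (hG : 1 < Nat.card G)
    (hβ : 0 < β) (hβ1 : β < 1) (hd : 0 < d) (hdε : d ≤ ε) (hεβ : 4 * ε ≤ β) (hεκ : ε ≤ κ)
    (hclass : ApproxSubgroupClassification G ε d) (hconc : NonConcentration μ κ)
    (W : Submodule ℝ (G → ℝ)) (hW : (Nat.card G : ℝ) ^ β ≤ Module.finrank ℝ W)
    (hWt : ∀ f ∈ W, conv μ f = (1 - t) • f) (hlarge : 40 ≤ (Nat.card G : ℝ) ^ (d / 5000)) :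
    β * Real.exp (-(1000010 / d)) ≤ t := by
  have hG1 : (1 : ℝ) < Nat.card G := Nat.one_lt_cast.2 hG
  have hG0 : (0 : ℝ) < Nat.card G := by linarith
  -- The least natural number exceeding `5000 / d`, so that `T ^ J > |G|` strictly.
  obtain ⟨J, hJ⟩ : ∃ J : ℕ, J = ⌊5000 / d⌋₊ + 1 := ⟨_, rfl⟩
  have hJ1 : 5000 / d < J := by rw [hJ]; push_cast; exact Nat.lt_floor_add_one _
  have hJ2 : (J : ℝ) ≤ 5000 / d + 1 := by
    rw [hJ]; push_cast; linarith [Nat.floor_le (show 0 ≤ 5000 / d by positivity)]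
  obtain ⟨n, hn, hflat⟩ := exists_convPow_flat hμ hdε hεκ hclass hconc rfl hlarge (J := J) (by
    rw [← Real.rpow_natCast, ← Real.rpow_mul hG0.le]
    refine Real.self_lt_rpow_of_one_lt hG1 ?_
    rw [div_lt_iff₀ hd] at hJ1
    linarith)
  have htrace : (1 - t) ^ (2 * n) ≤ (Nat.card G : ℝ) ^ (-(β / 2)) := by
    have h1 := finrank_mul_pow_le W hWt n
    have h0 : 0 ≤ (1 - t) ^ (2 * n) := by rw [pow_mul]; positivity
    have h2 : (Nat.card G : ℝ) ^ β * (1 - t) ^ (2 * n) ≤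
        (Nat.card G : ℝ) ^ β * (Nat.card G : ℝ) ^ (-(β / 2)) := by
      refine (mul_le_mul_of_nonneg_right hW h0).trans (h1.trans ?_)
      refine (mul_le_mul_of_nonneg_left hflat hG0.le).trans ?_
      rw [← Real.rpow_add hG0]
      nth_rewrite 1 [← Real.rpow_one (Nat.card G : ℝ)]
      rw [← Real.rpow_add hG0]
      exact Real.rpow_le_rpow_of_exponent_le hG1.le (by linarith)
    exact le_of_mul_le_mul_left h2 (by positivity)
  obtain ⟨τ, hτ⟩ : ∃ τ : ℝ, τ = β * Real.exp (-(1000010 / d)) := ⟨_, rfl⟩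
  rw [← hτ]
  by_contra! hlt
  have hτ0 : 0 < τ := by rw [hτ]; positivity
  have hd1 : d < 1 := by linarith
  have h1d : 1 ≤ 1 / d := by rw [le_div_iff₀ hd]; linarith
  have hτJ : 8 * 2 ^ J * τ < β := by
    have h1 : (2 : ℝ) ≤ Real.exp 1 := by linarith [Real.add_one_le_exp 1]
    have h2 : (8 : ℝ) * 2 ^ J ≤ Real.exp (J + 3 : ℕ) := by
      rw [← mul_one ((J + 3 : ℕ) : ℝ), Real.exp_nat_mul]
      calc (8 : ℝ) * 2 ^ J = 2 ^ (J + 3) := by ring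
        _ ≤ _ := pow_le_pow_left₀ (by norm_num) h1 _
    have h3 : Real.exp (J + 3 : ℕ) * Real.exp (-(1000010 / d)) < 1 := by
      rw [← Real.exp_add, Real.exp_lt_one_iff]
      have e1 : (5000 : ℝ) / d = 5000 * (1 / d) := by ring
      have e2 : (1000010 : ℝ) / d = 1000010 * (1 / d) := by ring
      push_cast
      linarith
    have h4 : 8 * 2 ^ J * Real.exp (-(1000010 / d)) < 1 :=
      (mul_le_mul_of_nonneg_right h2 (Real.exp_pos _).le).trans_lt h3
    rw [hτ]
    nlinarith
  have hτ2 : τ ≤ 1 / 2 := by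
    have : (1 : ℝ) ≤ 2 ^ J := one_le_pow₀ one_le_two
    nlinarith
  -- If `t < τ ≤ 1 / 2`, then `1 - t` is at least `exp (-2 τ)`. With the trace bound this yields `4
  -- τ n ≥ (β / 2) log |G|`, hence `8 * 2 ^ J * τ ≥ β`, contradicting `hτJ`.
  have hexp : Real.exp (-(2 * τ)) ≤ 1 - t := by
    have h1 := Real.add_one_le_exp (2 * τ)
    rw [Real.exp_neg]
    refine (inv_anti₀ (by linarith) h1).trans (le_trans ?_ (by linarith : 1 - τ ≤ 1 - t))
    rw [inv_le_iff_one_le_mul₀ (by linarith)]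
    nlinarith
  have h1 : Real.exp (((2 * n : ℕ) : ℝ) * -(2 * τ)) ≤ (Nat.card G : ℝ) ^ (-(β / 2)) := by
    rw [Real.exp_nat_mul]
    exact (pow_le_pow_left₀ (Real.exp_pos _).le hexp _).trans htrace
  rw [Real.rpow_def_of_pos hG0, Real.exp_le_exp] at h1
  push_cast at h1
  have hlog : 0 < Real.log (Nat.card G) := Real.log_pos hG1
  have h2 : 4 * τ * n ≤ 4 * τ * (2 ^ J * Real.log (Nat.card G)) :=
    mul_le_mul_of_nonneg_left hn (by positivity)
  nlinarith

end Gap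

end BGMachine

theorem proposition3p1 :
    ∃ C : ℝ, 0 < C ∧
      ∀ (G₀ : Type*) [Group G₀] [Fintype G₀] [Nontrivial G₀] (S₀ : Finset G₀),
        (∀ s ∈ S₀, s⁻¹ ∈ S₀) →
        Subgroup.closure (S₀ : Set G₀) = ⊤ →
        ∀ (β κ : ℝ), 0 < β → β < 1 → 0 < κ → κ < 1 →
        ∀ δ : ℝ → ℝ, (∀ ε : ℝ, 0 < ε → 0 < δ ε ∧ δ ε < ε) →
        -- the three conditions, for every quotient `G₀ ⧸ N`
        (∀ (N : Subgroup G₀) [N.Normal] [Fintype (G₀ ⧸ N)],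
          BGMachine.HighMultiplicity (G₀ ⧸ N) β ∧
          (∀ ε : ℝ, 0 < ε → BGMachine.ApproxSubgroupClassification (G₀ ⧸ N) ε (δ ε)) ∧
          BGMachine.NonConcentration
            (BGMachine.pushforward (QuotientGroup.mk' N) (BGMachine.uniformMeasure S₀)) κ) →
        β * Real.exp (-(C / δ (min β κ / 4))) ≤ BGMachine.lambda1 S₀ := by
  refine ⟨1000010, by norm_num, ?_⟩
  intro G₀ _ _ _ S₀ hsymm hgen β κ hβ hβ1 hκ hκ1 δ hδ hyp
  have hne : S₀.Nonempty := by
    rw [Finset.nonempty_iff_ne_empty]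
    rintro rfl
    simp at hgen
  have hε : 0 < min β κ / 4 := by positivity
  obtain ⟨hd, hdε⟩ := hδ _ hε
  have hεβ : 4 * (min β κ / 4) ≤ β := by linarith [min_le_left β κ]
  have hεκ : min β κ / 4 ≤ κ := by linarith [min_le_right β κ]
  -- Nonemptiness matters: the real infimum of the empty set is `0`.
  refine le_csInf (BGMachine.exists_laplacian_eigenvalue_ne_zero hsymm hgen) ?_
  rintro t ⟨ht, hev⟩
  obtain ⟨N, hN, hfin, W, hNtop, hWbot, hWdim, hW⟩ :=
    BGMachine.exists_quotient_eigenspace hne ht hev (β := β) fun N _ =>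
      let _ : Fintype (G₀ ⧸ N) := Fintype.ofFinite _
      (hyp N).1
  obtain ⟨-, hclass, hconc⟩ := hyp N
  have hμ := BGMachine.isSymmProb_pushforward (QuotientGroup.mk' N) hsymm hne
  have hcard : 1 < Nat.card (G₀ ⧸ N) := by
    have h1 : N.index ≠ 1 := mt Subgroup.index_eq_one.1 hNtop
    have h2 : N.index ≠ 0 := N.index_ne_zero_of_finite
    change 1 < N.index
    omega
  rcases le_total ((Nat.card (G₀ ⧸ N) : ℝ) ^ (δ (min β κ / 4) / 5000)) 40 with hs | hl
  · obtain ⟨f, hf, hf0⟩ := Submodule.exists_mem_ne_zero_of_ne_bot hWbot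
    have h1 := BGMachine.gap_ge_of_small hμ hκ1 hd (hdε.le.trans hεκ) hconc hf0 ht (hW f hf) hs
    refine le_trans ?_ h1
    exact mul_le_of_le_one_left (Real.exp_pos _).le hβ1.le
  · exact BGMachine.gap_ge_of_large hμ hcard hβ hβ1 hd hdε.le hεβ hεκ (hclass _ hε) hconc W hWdim
      hW hl
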